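/- Let $n\ge 2$ and let $s\in\{0,1\}$. Let $\tilde\phi\in C_c^\infty(\mathbb R^n)$ be real-valued with $\tilde\phi(\xi)=1$ for $|\xi|\le 1$ and $\tilde\phi(\xi)=0$ for $|\xi|>\frac76$, and set $\phi_c(\xi)=\tilde\phi(\xi)-\tilde\phi(2\xi)$. For $j\in\mathbb Z$ let $P_j$ be the Littlewood–Paley operator $\widehat{P_jf}(\xi)=\phi_c(2^{-j}\xi)\hat f(\xi)$, where $\hat f(\xi)=\int_{\mathbb R^n}e^{-ix\cdot\xi}f(x)\,dx$ (extended to $L^2$, and acting componentwise on vector fields), and for $\sigma\in\mathbb R$ let $$\|f\|_{\dot B^{\sigma}_{\infty,\infty}}=\sup_{j\in\mathbb Z}2^{j\sigma}\|P_jf\|_{L^\infty(\mathbb R^n)}.$$ For a divergence-free Schwartz vector field $u\in\mathcal S(\mathbb R^n;\mathbb R^n)$ let $p$ be the pressure $$p=\sum_{l,k=1}^n(-\Delta)^{-1}\partial_l\partial_k(u_lu_k)\in L^2(\mathbb R^n),\qquad \hat p(\xi)=-\sum_{l,k=1}^n\frac{\xi_l\xi_k}{|\xi|^2}\,\widehat{u_lu_k}(\xi).$$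 Then: 1. There is no finite constant $C$ such that $\|p\|_{\dot B^{2s}_{\infty,\infty}}\le C\|u\|_{\dot B^{s}_{\infty,\infty}}^2$ for all divergence-free $u\in\mathcal S(\mathbb R^n;\mathbb R^n)$. 2. For every $\varepsilon>0$ and every $N\in\mathbb Z$ there is a divergence-free $u\in\mathcal S(\mathbb R^n;\mathbb R^n)$ with $$\|u\|_{\dot B^{s}_{\infty,\infty}}+\|u\|_{L^2}\le 1\qquad\text{and}\qquad \|p\|_{\dot B^{2s}_{\infty,\infty}}>\frac1\varepsilon,$$ and moreover the inflation occurs at high frequency: there is $j\ge N$ with $2^{2sj}\|P_jp\|_{L^\infty}>\frac1\varepsilon$. -/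

import Mathlib

open MeasureTheory FourierTransform
open scoped SchwartzMap ENNReal NNReal ContDiff

noncomputable section

namespace EulerPressure

/-- A Littlewood-Paley cutoff: a real function in `C_c^∞(ℝⁿ)` equal to `1` for `|ξ| ≤ 1` and to `0`
for `|ξ| > 7/6` (so that its support is automatically compact). -/
structure LPCutoff (n : ℕ) where
  toFun : EuclideanSpace ℝ (Fin n) → ℝ
  smooth : ContDiff ℝ ∞ toFun
  eq_one : ∀ ξ, ‖ξ‖ ≤ 1 → toFun ξ = 1
  eq_zero : ∀ ξ, 7 / 6 < ‖ξ‖ → toFun ξ = 0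

/-- Such cutoffs exist. -/
instance (n : ℕ) : Nonempty (LPCutoff n) := by
  let b : ContDiffBump (0 : EuclideanSpace ℝ (Fin n)) := ⟨1, 7 / 6, by norm_num, by norm_num⟩
  refine ⟨⟨b, b.contDiff, fun ξ h => b.one_of_mem_closedBall (by simpa [b] using h),
    fun ξ h => b.zero_of_le_dist (by simpa [b] using h.le)⟩⟩

/-- The annular cutoff `φ_c(ξ) = χ(ξ) - χ(2ξ)`. -/
def LPCutoff.annulus {n : ℕ} (χ : LPCutoff n) (ξ : EuclideanSpace ℝ (Fin n)) : ℝ :=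
  χ.toFun ξ - χ.toFun ((2 : ℝ) • ξ)

/-- The symbol `φ_c(2^{-j} ξ)` of `P_j`, where `ξ = 2πζ` is the frequency variable of
`∫ e^{-i x·ξ} f(x) dx`, and `ζ` that of Mathlib's Fourier transform `∫ e^{-2πi x·ζ} f(x) dx`. -/
def LPCutoff.symbol {n : ℕ} (χ : LPCutoff n) (j : ℤ) (ζ : EuclideanSpace ℝ (Fin n)) : ℂ :=
  (χ.annulus ((2 : ℝ) ^ (-j) • ((2 * Real.pi) • ζ)) : ℝ)

lemma LPCutoff.exists_bound {n : ℕ} (χ : LPCutoff n) : ∃ C, ∀ ξ, ‖χ.toFun ξ‖ ≤ C := by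
  refine χ.smooth.continuous.bounded_above_of_compact_support ?_
  refine HasCompactSupport.intro (isCompact_closedBall 0 (7 / 6)) fun ξ hξ => χ.eq_zero ξ ?_
  simpa using hξ

lemma LPCutoff.memLp_symbol {n : ℕ} (χ : LPCutoff n) (j : ℤ) :
    MemLp (χ.symbol j) ∞ (volume : Measure (EuclideanSpace ℝ (Fin n))) := by
  obtain ⟨C, hC⟩ := χ.exists_bound
  have hc : Continuous (χ.symbol j) := by
    have := χ.smooth.continuous
    unfold LPCutoff.symbol LPCutoff.annulus
    fun_prop
  refine memLp_top_of_bound hc.aestronglyMeasurable (C + C) (Filter.Eventually.of_forall fun ζ => ?_)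
  rw [LPCutoff.symbol, Complex.norm_real]
  exact (norm_sub_le _ _).trans (add_le_add (hC _) (hC _))

/-- The Fourier multiplier on `L²(ℝⁿ; F)` with bounded symbol `m` (a function of `ζ`). -/
def fourierMult {n : ℕ} {F : Type*} [NormedAddCommGroup F] [InnerProductSpace ℂ F]
    [CompleteSpace F] (m : EuclideanSpace ℝ (Fin n) → ℂ) (hm : MemLp m ∞ volume)
    (f : Lp (α := EuclideanSpace ℝ (Fin n)) F 2) : Lp (α := EuclideanSpace ℝ (Fin n)) F 2 :=
  𝓕⁻ ((hm.toLp m • 𝓕 f : Lp (α := EuclideanSpace ℝ (Fin n)) F 2))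

/-- The Littlewood-Paley block `P_j f`, for `f ∈ L²(ℝⁿ; F)`. -/
def lpBlock {n : ℕ} {F : Type*} [NormedAddCommGroup F] [InnerProductSpace ℂ F]
    [CompleteSpace F] (χ : LPCutoff n) (j : ℤ) (f : Lp (α := EuclideanSpace ℝ (Fin n)) F 2) :
    Lp (α := EuclideanSpace ℝ (Fin n)) F 2 :=
  fourierMult (χ.symbol j) (χ.memLp_symbol j) f

/-- The weighted size `2^{js} ‖P_j f‖_{L^∞}` of a Littlewood-Paley block. -/
def blockNorm {n : ℕ} {F : Type*} [NormedAddCommGroup F] [InnerProductSpace ℂ F]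
    [CompleteSpace F] (χ : LPCutoff n) (s : ℝ) (j : ℤ)
    (f : Lp (α := EuclideanSpace ℝ (Fin n)) F 2) : ℝ≥0∞ :=
  ENNReal.ofReal ((2 : ℝ) ^ ((j : ℝ) * s)) * eLpNorm (lpBlock χ j f) ∞ volume

/-- The homogeneous Besov (semi)norm of `Ḃ^s_{∞,∞}(ℝⁿ)`, with values in `[0,∞]`. -/
def besovNorm {n : ℕ} {F : Type*} [NormedAddCommGroup F] [InnerProductSpace ℂ F]
    [CompleteSpace F] (χ : LPCutoff n) (s : ℝ)
    (f : Lp (α := EuclideanSpace ℝ (Fin n)) F 2) : ℝ≥0∞ :=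
  ⨆ j : ℤ, blockNorm χ s j f

/-- The inclusion of `ℝⁿ` in `ℂⁿ`. -/
def complexify (n : ℕ) : EuclideanSpace ℝ (Fin n) →L[ℝ] EuclideanSpace ℂ (Fin n) :=
  LinearMap.toContinuousLinearMap
    { toFun := fun x => WithLp.toLp 2 fun k => (x k : ℂ)
      map_add' := fun x y => by ext k; simp
      map_smul' := fun c x => by ext k; simp }

/-- A Schwartz velocity field as an element of `L²(ℝⁿ; ℂⁿ)`. -/
def velocityL2 {n : ℕ} (u : 𝓢(EuclideanSpace ℝ (Fin n), EuclideanSpace ℝ (Fin n))) :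
    Lp (α := EuclideanSpace ℝ (Fin n)) (EuclideanSpace ℂ (Fin n)) 2 :=
  (SchwartzMap.postcompCLM (complexify n) u).toLp 2

/-- `∇ · u = 0`. -/
def IsDivFree {n : ℕ} (u : 𝓢(EuclideanSpace ℝ (Fin n), EuclideanSpace ℝ (Fin n))) : Prop :=
  ∀ x, ∑ k, (fderiv ℝ u x (EuclideanSpace.single k 1)) k = 0

/-- The `k`-th component of a velocity field, as a complex-valued Schwartz function. -/
def component {n : ℕ} (u : 𝓢(EuclideanSpace ℝ (Fin n), EuclideanSpace ℝ (Fin n))) (k : Fin n) :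
    𝓢(EuclideanSpace ℝ (Fin n), ℂ) :=
  SchwartzMap.postcompCLM (Complex.ofRealCLM ∘L EuclideanSpace.proj k) u

/-- The symbol `|ξ|⁻² (iξ_l)(iξ_k) = -ξ_l ξ_k / |ξ|²` of `(-Δ)⁻¹ ∂_l ∂_k`; it is homogeneous of
degree `0`, so it is the same in the variables `ξ` and `ζ = ξ / 2π`. -/
def pressureSymbol {n : ℕ} (l k : Fin n) (ζ : EuclideanSpace ℝ (Fin n)) : ℂ :=
  (-(ζ l * ζ k) / ‖ζ‖ ^ 2 : ℝ)

lemma memLp_pressureSymbol {n : ℕ} (l k : Fin n) :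
    MemLp (pressureSymbol l k) ∞ (volume : Measure (EuclideanSpace ℝ (Fin n))) := by
  have hm : Measurable (pressureSymbol l k) := by
    unfold pressureSymbol
    fun_prop
  refine memLp_top_of_bound hm.aestronglyMeasurable 1 (Filter.Eventually.of_forall fun ζ => ?_)
  rw [pressureSymbol, Complex.norm_real, norm_div, norm_neg, norm_mul, norm_pow, norm_norm, sq]
  exact div_le_one_of_le₀ (mul_le_mul (PiLp.norm_apply_le ζ l) (PiLp.norm_apply_le ζ k)
    (norm_nonneg _) (norm_nonneg _)) (by positivity)

/-- The pressure `p = ∑_{l,k} (-Δ)⁻¹ ∂_l ∂_k (u_l u_k)`, an element of `L²(ℝⁿ)`. -/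
def pressure {n : ℕ} (u : 𝓢(EuclideanSpace ℝ (Fin n), EuclideanSpace ℝ (Fin n))) :
    Lp (α := EuclideanSpace ℝ (Fin n)) ℂ 2 :=
  ∑ l, ∑ k, fourierMult (pressureSymbol l k) (memLp_pressureSymbol l k)
    ((SchwartzMap.pairing (ContinuousLinearMap.mul ℂ ℂ) (component u l) (component u k)).toLp 2)

end EulerPressure

end

/-! The pressure is quadratic in `u`, while the Besov norm controls each dyadic piece of `u`
separately. Many pieces of size `O(1)` can therefore send interactions into one block of `p`; if all
contributions have the same sign, `N` of them add up to a multiple of `N`.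

The sign is arranged by taking the Fourier transform of `u` to be `i g(ζ) rot ζ`, with `g` real and
even and `rot` a quarter turn in a coordinate plane. By `exists_velocity_of_profile`, the value of
`P_j p` at the origin is then, up to sign, the integral of `K(x + y) (x × y)² g(x) g(y)`, where
`K(ζ)` is the rescaled annular cutoff over `‖ζ‖²`. The block norms of `u` are at most weighted `L¹`
masses of `‖ζ‖ |g|`.

The profile `g` is a sum of bumps at frequencies of size `R = 4^(k+1)`, with weights `R^-(σ+1)`. For
`σ = 0`, nearly opposite frequencies of size `R` interact to give one fixed low frequency. For `σ =
1`, one high frequency interacts with all the lower ones, and the sums stay in the high block. In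
both cases each pair contributes a constant independent of `k` (`le_pressureForm`), while each block
of `u` sees boundedly many bumps (`blockMass_lacunary_le`).

Finally, `InflationProfile.exists_velocity` dilates the profile: the Besov quantities are invariant
under the chosen scaling, the block index moves up, and the `L²` norm becomes small. -/

noncomputable section

namespace EulerPressure

variable {n : ℕ}

/-! ### Fourier multipliers on Schwartz functions and sup-norm bounds -/

section Multipliers

variable {F : Type*} [NormedAddCommGroup F] [InnerProductSpace ℂ F]

lemma smul_toLp_schwartz {m : EuclideanSpace ℝ (Fin n) → ℂ} (hm : MemLp m ∞ volume)
    (ht : m.HasTemperateGrowth) (f : 𝓢(EuclideanSpace ℝ (Fin n), F)) :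
    (hm.toLp m • f.toLp 2 : Lp (α := EuclideanSpace ℝ (Fin n)) F 2) =
      (SchwartzMap.smulLeftCLM F m f).toLp 2 := by
  apply Lp.ext
  filter_upwards [Lp.coeFn_lpSMul (r := 2) (hm.toLp m) (f.toLp 2), hm.coeFn_toLp,
    f.coeFn_toLp 2 volume, (SchwartzMap.smulLeftCLM F m f).coeFn_toLp 2 volume] with x h1 h2 h3 h4
  rw [h1, h4, Pi.smul_apply', h2, h3, SchwartzMap.smulLeftCLM_apply_apply ht]

lemma fourierMult_toLp [CompleteSpace F] {m : EuclideanSpace ℝ (Fin n) → ℂ} (hm : MemLp m ∞ volume)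
    (ht : m.HasTemperateGrowth) (f : 𝓢(EuclideanSpace ℝ (Fin n), F)) :
    fourierMult m hm (f.toLp 2) = (𝓕⁻ (SchwartzMap.smulLeftCLM F m (𝓕 f))).toLp 2 := by
  rw [fourierMult, SchwartzMap.toLp_fourier_eq, smul_toLp_schwartz hm ht,
    SchwartzMap.toLp_fourierInv_eq]

lemma fourierMult_fourierMult [CompleteSpace F] {m₁ m₂ : EuclideanSpace ℝ (Fin n) → ℂ} (h₁ : MemLp m₁ ∞ volume)
    (h₂ : MemLp m₂ ∞ volume) (h : MemLp (fun ζ => m₁ ζ * m₂ ζ) ∞ volume)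
    (f : Lp (α := EuclideanSpace ℝ (Fin n)) F 2) :
    fourierMult m₁ h₁ (fourierMult m₂ h₂ f) = fourierMult _ h f := by
  rw [fourierMult, fourierMult, fourier_fourierInv_eq, fourierMult]
  congr 1
  apply Lp.ext
  filter_upwards [Lp.coeFn_lpSMul (r := 2) (h₁.toLp m₁)
      (h₂.toLp m₂ • 𝓕 f : Lp (α := EuclideanSpace ℝ (Fin n)) F 2),
    Lp.coeFn_lpSMul (r := 2) (h₂.toLp m₂) (𝓕 f),
    Lp.coeFn_lpSMul (r := 2) (h.toLp _) (𝓕 f),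
    h₁.coeFn_toLp, h₂.coeFn_toLp, h.coeFn_toLp] with x e1 e2 e3 e4 e5 e6
  rw [e1, e3, Pi.smul_apply', Pi.smul_apply', e2, Pi.smul_apply', e4, e5, e6, smul_smul]

lemma fourierMult_add [CompleteSpace F] (m : EuclideanSpace ℝ (Fin n) → ℂ) (hm : MemLp m ∞ volume)
    (f g : Lp (α := EuclideanSpace ℝ (Fin n)) F 2 volume) :
    fourierMult m hm (f + g) = fourierMult m hm f + fourierMult m hm g := by
  rw [fourierMult, FourierTransform.fourier_add, Lp.add_smul, FourierTransform.fourierInv_add]; rfl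

lemma fourierMult_sum [CompleteSpace F] {ι : Type*} (m : EuclideanSpace ℝ (Fin n) → ℂ) (hm : MemLp m ∞ volume)
    (t : Finset ι) (f : ι → Lp (α := EuclideanSpace ℝ (Fin n)) F 2) :
    fourierMult m hm (∑ i ∈ t, f i) = ∑ i ∈ t, fourierMult m hm (f i) :=
  map_sum (AddMonoidHom.mk' (fourierMult m hm) (fourierMult_add m hm)) f t

lemma eLpNorm_top_schwartz_le {f : 𝓢(EuclideanSpace ℝ (Fin n), F)} :
    eLpNorm ((𝓕⁻ f).toLp 2 volume) ∞ volume ≤ ENNReal.ofReal (∫ ζ, ‖f ζ‖) := by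
  refine eLpNormEssSup_le_of_ae_bound ?_
  filter_upwards [(𝓕⁻ f).coeFn_toLp 2 volume] with x hx
  rw [hx, SchwartzMap.fourierInv_coe, Real.fourierInv_eq]
  refine (norm_integral_le_integral_norm _).trans (le_of_eq ?_)
  simp only [Circle.norm_smul]

/-- The set where the bound holds is closed by continuity and dense because it has full measure.
Thus one point value, here taken at the origin, bounds a block from below. -/
lemma norm_le_eLpNorm_top_schwartz (f : 𝓢(EuclideanSpace ℝ (Fin n), F))
    (x : EuclideanSpace ℝ (Fin n)) :
    ENNReal.ofReal ‖f x‖ ≤ eLpNorm (f.toLp 2 volume) ∞ volume := by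
  rw [eLpNorm_congr_ae (f.coeFn_toLp 2 volume), ofReal_norm]
  have hd : Dense {y | ‖f y‖ₑ ≤ eLpNorm f ∞ volume} := by
    apply Measure.dense_of_ae (μ := volume)
    rw [eLpNorm_exponent_top]
    exact ae_le_eLpNormEssSup
  have hc : IsClosed {y | ‖f y‖ₑ ≤ eLpNorm f ∞ volume} :=
    isClosed_le f.continuous.enorm continuous_const
  exact (hc.closure_eq ▸ hd.closure_eq).ge (Set.mem_univ x)

end Multipliers

/-! ### The annular cutoff and its product with the pressure symbol -/

lemma LPCutoff.contDiff_annulus (χ : LPCutoff n) : ContDiff ℝ ∞ χ.annulus :=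
  χ.smooth.sub (χ.smooth.comp (contDiff_const_smul _))

lemma LPCutoff.annulus_eq_zero_of_le (χ : LPCutoff n) {ξ : EuclideanSpace ℝ (Fin n)}
    (h : ‖ξ‖ ≤ 1 / 2) : χ.annulus ξ = 0 := by
  rw [annulus, χ.eq_one ξ (by linarith), χ.eq_one, sub_self]
  rw [norm_smul]; norm_num; linarith

lemma LPCutoff.annulus_eq_zero_of_lt (χ : LPCutoff n) {ξ : EuclideanSpace ℝ (Fin n)}
    (h : 7 / 6 < ‖ξ‖) : χ.annulus ξ = 0 := by
  rw [annulus, χ.eq_zero ξ h, χ.eq_zero, sub_self]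
  rw [norm_smul]; norm_num; linarith

/-- Nothing is known about the sign of the cutoff in the transition zones `1/2 < ‖ξ‖ ≤ 7/12` and `1
< ‖ξ‖ ≤ 7/6`. The profiles below are placed so that no sum of two of their frequencies meets these
zones. -/
lemma LPCutoff.annulus_eq_one (χ : LPCutoff n) {ξ : EuclideanSpace ℝ (Fin n)}
    (h : 7 / 12 < ‖ξ‖) (h' : ‖ξ‖ ≤ 1) : χ.annulus ξ = 1 := by
  rw [annulus, χ.eq_one ξ h', χ.eq_zero, sub_zero]
  rw [norm_smul]; norm_num; linarith

lemma LPCutoff.exists_annulus_bound (χ : LPCutoff n) : ∃ C, 0 < C ∧ ∀ ξ, |χ.annulus ξ| ≤ C := by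
  obtain ⟨C, hC⟩ := χ.exists_bound
  have h0 : 0 ≤ C := (norm_nonneg _).trans (hC 0)
  exact ⟨C + C + 1, by linarith, fun ξ =>
    ((norm_sub_le _ _).trans (add_le_add (hC _) (hC _))).trans (by linarith)⟩

lemma LPCutoff.contDiff_symbol (χ : LPCutoff n) (j : ℤ) : ContDiff ℝ ∞ (χ.symbol j) := by
  refine Complex.ofRealCLM.contDiff.comp (χ.contDiff_annulus.comp ?_)
  fun_prop

lemma norm_symbol_arg (j : ℤ) (ζ : EuclideanSpace ℝ (Fin n)) :
    ‖(2 : ℝ) ^ (-j) • ((2 * Real.pi) • ζ)‖ = 2 ^ (-j) * (2 * Real.pi) * ‖ζ‖ := by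
  rw [norm_smul, norm_smul, Real.norm_of_nonneg (by positivity), Real.norm_of_nonneg (by positivity),
    ← mul_assoc]

lemma LPCutoff.hasCompactSupport_symbol (χ : LPCutoff n) (j : ℤ) :
    HasCompactSupport (χ.symbol j) := by
  have hp : 0 < (2 : ℝ) ^ (-j) * (2 * Real.pi) := by positivity
  refine HasCompactSupport.intro
    (isCompact_closedBall 0 (7 / 6 / ((2 : ℝ) ^ (-j) * (2 * Real.pi)))) fun ζ hζ => ?_
  rw [symbol, χ.annulus_eq_zero_of_lt, Complex.ofReal_zero]
  rw [norm_symbol_arg]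
  rw [mem_closedBall_zero_iff, not_le, div_lt_iff₀ hp] at hζ
  linarith

lemma LPCutoff.hasTemperateGrowth_symbol (χ : LPCutoff n) (j : ℤ) :
    (χ.symbol j).HasTemperateGrowth :=
  (χ.hasCompactSupport_symbol j).hasTemperateGrowth (χ.contDiff_symbol j)

lemma LPCutoff.symbol_eventually_eq_zero (χ : LPCutoff n) (j : ℤ) :
    χ.symbol j =ᶠ[nhds 0] 0 := by
  have hc : Continuous fun ζ : EuclideanSpace ℝ (Fin n) =>
      ‖(2 : ℝ) ^ (-j) • ((2 * Real.pi) • ζ)‖ := by fun_prop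
  filter_upwards [hc.continuousAt.eventually_lt (continuousAt_const (y := (1 / 2 : ℝ)))
    (by simp)] with ζ hζ
  rw [symbol, χ.annulus_eq_zero_of_le hζ.le]; simp

/-- The pressure symbol is singular only at the origin, where the cutoff vanishes identically
nearby. Hence `P_j p` has a Schwartz representative, although `p` is only treated as an `L²`
function. -/
lemma LPCutoff.contDiff_symbol_mul_pressureSymbol (χ : LPCutoff n) (j : ℤ) (l k : Fin n) :
    ContDiff ℝ ∞ fun ζ => χ.symbol j ζ * pressureSymbol l k ζ := by
  rw [contDiff_iff_contDiffAt]
  intro ζ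
  by_cases h : ζ = 0
  · subst h
    refine (contDiffAt_const (c := (0 : ℂ))).congr_of_eventuallyEq ?_
    filter_upwards [χ.symbol_eventually_eq_zero j] with ζ hζ
    simp [hζ]
  · refine (χ.contDiff_symbol j).contDiffAt.mul (Complex.ofRealCLM.contDiff.contDiffAt.comp ζ ?_)
    refine ContDiffAt.div ?_ (contDiff_norm_sq ℝ).contDiffAt (by simpa using h)
    fun_prop

lemma LPCutoff.hasTemperateGrowth_symbol_mul_pressureSymbol (χ : LPCutoff n) (j : ℤ)
    (l k : Fin n) :
    (fun ζ => χ.symbol j ζ * pressureSymbol l k ζ).HasTemperateGrowth :=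
  HasCompactSupport.hasTemperateGrowth (χ.hasCompactSupport_symbol j).mul_right
    (χ.contDiff_symbol_mul_pressureSymbol j l k)

lemma LPCutoff.memLp_symbol_mul_pressureSymbol (χ : LPCutoff n) (j : ℤ) (l k : Fin n) :
    MemLp (fun ζ => χ.symbol j ζ * pressureSymbol l k ζ) ∞ volume :=
  (χ.contDiff_symbol_mul_pressureSymbol j l k).continuous.memLp_top_of_hasCompactSupport
    (χ.hasCompactSupport_symbol j).mul_right volume

/-! ### Real divergence-free fields from Fourier data -/

/-- The componentwise real part. -/
def realPart (n : ℕ) : EuclideanSpace ℂ (Fin n) →L[ℝ] EuclideanSpace ℝ (Fin n) :=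
  LinearMap.toContinuousLinearMap
    { toFun := fun x => WithLp.toLp 2 fun k => (x k).re
      map_add' := fun x y => by ext k; simp
      map_smul' := fun c x => by ext k; simp }

@[simp] lemma realPart_apply (x : EuclideanSpace ℂ (Fin n)) (k : Fin n) :
    realPart n x k = (x k).re := rfl

@[simp] lemma complexify_apply (x : EuclideanSpace ℝ (Fin n)) (k : Fin n) :
    complexify n x k = (x k : ℂ) := rfl

lemma norm_complexify (x : EuclideanSpace ℝ (Fin n)) : ‖complexify n x‖ = ‖x‖ := by
  simp [EuclideanSpace.norm_eq]

lemma fourierInv_apply_coord (H : 𝓢(EuclideanSpace ℝ (Fin n), EuclideanSpace ℂ (Fin n)))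
    (k : Fin n) (x : EuclideanSpace ℝ (Fin n)) :
    (𝓕⁻ H) x k = ∫ ζ, Real.fourierChar (inner ℝ ζ x) • H ζ k := by
  rw [SchwartzMap.fourierInv_coe, Real.fourierInv_eq]
  have hi : Integrable (fun ζ => Real.fourierChar (inner ℝ ζ x) • H ζ) := by
    have := (Real.fourierIntegral_convergent_iff (μ := volume) (f := H) (-x)).2 H.integrable
    simpa using this
  exact ((EuclideanSpace.proj k : EuclideanSpace ℂ (Fin n) →L[ℂ] ℂ).integral_comp_comm hi).symm

lemma fourierInv_postcomp_proj (H : 𝓢(EuclideanSpace ℝ (Fin n), EuclideanSpace ℂ (Fin n)))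
    (k : Fin n) :
    SchwartzMap.postcompCLM (EuclideanSpace.proj k : EuclideanSpace ℂ (Fin n) →L[ℂ] ℂ) (𝓕⁻ H) =
    𝓕⁻ (SchwartzMap.postcompCLM (EuclideanSpace.proj k : EuclideanSpace ℂ (Fin n) →L[ℂ] ℂ) H) := by
  ext x
  rw [SchwartzMap.postcompCLM_apply, SchwartzMap.fourierInv_coe (SchwartzMap.postcompCLM _ H),
    Real.fourierInv_eq]
  exact fourierInv_apply_coord H k x

lemma conj_fourierInv_coord (H : 𝓢(EuclideanSpace ℝ (Fin n), EuclideanSpace ℂ (Fin n)))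
    (hH : ∀ ζ k, H (-ζ) k = starRingEnd ℂ (H ζ k)) (x : EuclideanSpace ℝ (Fin n)) (k : Fin n) :
    starRingEnd ℂ ((𝓕⁻ H) x k) = (𝓕⁻ H) x k := by
  rw [fourierInv_apply_coord, ← integral_conj, ← integral_neg_eq_self]
  congr 1
  ext ζ
  rw [hH, inner_neg_left, Circle.smul_def, Circle.smul_def, smul_eq_mul, smul_eq_mul, map_mul,
    Complex.conj_conj, AddChar.map_neg_eq_inv, Circle.coe_inv_eq_conj, Complex.conj_conj]

/-- A Schwartz field with conjugation-symmetric Fourier transform `H` orthogonal to the frequency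
comes from a real divergence-free field. -/
lemma exists_velocity (H : 𝓢(EuclideanSpace ℝ (Fin n), EuclideanSpace ℂ (Fin n)))
    (hH : ∀ ζ k, H (-ζ) k = starRingEnd ℂ (H ζ k))
    (hdiv : ∀ ζ : EuclideanSpace ℝ (Fin n), ∑ k, (ζ k : ℂ) * H ζ k = 0) :
    ∃ u : 𝓢(EuclideanSpace ℝ (Fin n), EuclideanSpace ℝ (Fin n)), IsDivFree u ∧
      SchwartzMap.postcompCLM (complexify n) u = 𝓕⁻ H := by
  refine ⟨SchwartzMap.postcompCLM (realPart n) (𝓕⁻ H), ?_, ?_⟩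
  swap
  · ext x k
    rw [SchwartzMap.postcompCLM_apply, SchwartzMap.postcompCLM_apply, complexify_apply,
      realPart_apply]
    exact Complex.conj_eq_iff_re.1 (conj_fourierInv_coord H hH x k)
  · intro x
    -- `G k` is `2πi ζ_k H`, the Fourier side of the `k`-th partial derivative; summing its `k`-th
    -- coordinates gives the contraction killed by `hdiv`.
    set G : Fin n → 𝓢(EuclideanSpace ℝ (Fin n), EuclideanSpace ℂ (Fin n)) := fun k =>
      (2 * Real.pi * Complex.I) •
        SchwartzMap.smulLeftCLM _ (inner ℝ · (EuclideanSpace.single k (1 : ℝ))) H with hG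
    have h1 : ∀ k, (fderiv ℝ (SchwartzMap.postcompCLM (realPart n) (𝓕⁻ H)) x
        (EuclideanSpace.single k 1)) k = ((𝓕⁻ (G k)) x k).re := by
      intro k
      have hc : (⇑(SchwartzMap.postcompCLM (realPart n) (𝓕⁻ H)) : _ → _) =
        fun y => realPart n ((𝓕⁻ H) y) := rfl
      rw [hc, fderiv_fun_comp x (realPart n).differentiableAt (𝓕⁻ H).differentiableAt,
        ContinuousLinearMap.fderiv, ContinuousLinearMap.comp_apply, realPart_apply, hG,
        ← SchwartzMap.lineDerivOp_fourierInv_eq, SchwartzMap.lineDerivOp_apply_eq_fderiv]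
    rw [Finset.sum_congr rfl fun k _ => h1 k, ← Complex.re_sum]
    have ht : ∀ k : Fin n, (fun ζ : EuclideanSpace ℝ (Fin n) =>
        inner ℝ ζ (EuclideanSpace.single k (1 : ℝ))).HasTemperateGrowth := fun k => by fun_prop
    have h2 : ∀ k ζ, G k ζ k = (2 * Real.pi * Complex.I) * ((ζ k : ℂ) * H ζ k) := by
      intro k ζ
      rw [hG, smul_apply, SchwartzMap.smulLeftCLM_apply_apply (ht k)]
      simp [EuclideanSpace.inner_single_right]
    have h3 : ∑ k, (𝓕⁻ (G k)) x k = 0 := by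
      simp_rw [fourierInv_apply_coord, Circle.smul_def, h2]
      rw [← integral_finsetSum]
      · simp_rw [smul_eq_mul, ← Finset.mul_sum, hdiv]
        simp
      · intro k _
        have := (Real.fourierIntegral_convergent_iff (μ := volume)
          (f := SchwartzMap.postcompCLM (EuclideanSpace.proj k : _ →L[ℂ] ℂ) (G k)) (-x)).2
          (SchwartzMap.integrable _)
        simpa [Circle.smul_def, h2] using this
    rw [h3, Complex.zero_re]

/-! ### Norms of the velocity and blocks of the pressure in Fourier variables -/

lemma velocityL2_eq {u : 𝓢(EuclideanSpace ℝ (Fin n), EuclideanSpace ℝ (Fin n))}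
    {H : 𝓢(EuclideanSpace ℝ (Fin n), EuclideanSpace ℂ (Fin n))}
    (hu : SchwartzMap.postcompCLM (complexify n) u = 𝓕⁻ H) :
    velocityL2 u = (𝓕⁻ H).toLp 2 := by
  rw [velocityL2, hu]

lemma component_eq {u : 𝓢(EuclideanSpace ℝ (Fin n), EuclideanSpace ℝ (Fin n))}
    {H : 𝓢(EuclideanSpace ℝ (Fin n), EuclideanSpace ℂ (Fin n))}
    (hu : SchwartzMap.postcompCLM (complexify n) u = 𝓕⁻ H) (k : Fin n) :
    component u k =
      𝓕⁻ (SchwartzMap.postcompCLM (EuclideanSpace.proj k : _ →L[ℂ] ℂ) H) := by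
  rw [← fourierInv_postcomp_proj, ← hu]
  rfl

lemma blockNorm_velocityL2_le (χ : LPCutoff n) (s : ℝ) (j : ℤ)
    {u : 𝓢(EuclideanSpace ℝ (Fin n), EuclideanSpace ℝ (Fin n))}
    {H : 𝓢(EuclideanSpace ℝ (Fin n), EuclideanSpace ℂ (Fin n))}
    (hu : SchwartzMap.postcompCLM (complexify n) u = 𝓕⁻ H) :
    blockNorm χ s j (velocityL2 u) ≤
      ENNReal.ofReal (2 ^ ((j : ℝ) * s) * ∫ ζ, ‖χ.symbol j ζ‖ * ‖H ζ‖) := by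
  rw [blockNorm, ENNReal.ofReal_mul (by positivity), lpBlock, velocityL2_eq hu,
    fourierMult_toLp _ (χ.hasTemperateGrowth_symbol j), FourierTransform.fourier_fourierInv_eq]
  gcongr
  refine eLpNorm_top_schwartz_le.trans_eq ?_
  simp_rw [SchwartzMap.smulLeftCLM_apply_apply (χ.hasTemperateGrowth_symbol j), norm_smul]

lemma eLpNorm_velocity_eq {u : 𝓢(EuclideanSpace ℝ (Fin n), EuclideanSpace ℝ (Fin n))}
    {H : 𝓢(EuclideanSpace ℝ (Fin n), EuclideanSpace ℂ (Fin n))}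
    (hu : SchwartzMap.postcompCLM (complexify n) u = 𝓕⁻ H) :
    eLpNorm u 2 volume = ENNReal.ofReal (√(∫ ζ, ‖H ζ‖ ^ 2)) := by
  have h1 : eLpNorm u 2 volume = eLpNorm (fun x => (𝓕⁻ H) x) 2 volume := by
    rw [← hu]
    refine eLpNorm_congr_norm_ae (Filter.Eventually.of_forall fun x => ?_)
    rw [SchwartzMap.postcompCLM_apply, norm_complexify]
  have h2 : ∫ x, ‖(𝓕⁻ H) x‖ ^ 2 = ∫ ζ, ‖H ζ‖ ^ 2 := by
    have := SchwartzMap.integral_norm_sq_fourier (𝓕⁻ H)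
    rwa [FourierTransform.fourier_fourierInv_eq, eq_comm] at this
  have hm : MemLp (fun x => (𝓕⁻ H) x) 2 volume := SchwartzMap.memLp _ 2 volume
  rw [h1, hm.eLpNorm_eq_integral_rpow_norm (by norm_num) (by norm_num), ← h2,
    Real.sqrt_eq_rpow]
  norm_num

lemma fourierInv_zero_apply (f : 𝓢(EuclideanSpace ℝ (Fin n), ℂ)) : (𝓕⁻ f) 0 = ∫ ζ, f ζ := by
  rw [SchwartzMap.fourierInv_coe, Real.fourierInv_eq]
  simp

open ContinuousLinearMap in
lemma fourier_pairing_fourierInv (f g : 𝓢(EuclideanSpace ℝ (Fin n), ℂ))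
    (ζ : EuclideanSpace ℝ (Fin n)) :
    𝓕 (SchwartzMap.pairing (mul ℂ ℂ) (𝓕⁻ f) (𝓕⁻ g)) ζ = ∫ t, f t * g (ζ - t) := by
  have h : SchwartzMap.pairing (mul ℂ ℂ) (𝓕⁻ f) (𝓕⁻ g) =
      𝓕⁻ (SchwartzMap.convolution (mul ℂ ℂ) f g) := by
    ext x
    rw [SchwartzMap.pairing_apply_apply, SchwartzMap.fourierInv_coe, SchwartzMap.fourierInv_coe,
      SchwartzMap.fourierInv_coe, Real.fourierInv_eq_fourier_neg, Real.fourierInv_eq_fourier_neg,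
      Real.fourierInv_eq_fourier_neg, ← SchwartzMap.fourier_coe (SchwartzMap.convolution _ f g),
      SchwartzMap.fourier_convolution_apply,
      Real.fourier_bilin_convolution_eq _ f.integrable g.integrable]
  rw [h, FourierTransform.fourier_fourierInv_eq, SchwartzMap.convolution_apply]
  rfl

/-- The Schwartz representative of `P_j p`. -/
def pressureBlock (χ : LPCutoff n) (j : ℤ)
    (u : 𝓢(EuclideanSpace ℝ (Fin n), EuclideanSpace ℝ (Fin n))) :
    𝓢(EuclideanSpace ℝ (Fin n), ℂ) :=
  ∑ l, ∑ k, 𝓕⁻ (SchwartzMap.smulLeftCLM ℂ (fun ζ => χ.symbol j ζ * pressureSymbol l k ζ)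
    (𝓕 (SchwartzMap.pairing (ContinuousLinearMap.mul ℂ ℂ) (component u l) (component u k))))

lemma lpBlock_pressure (χ : LPCutoff n) (j : ℤ)
    (u : 𝓢(EuclideanSpace ℝ (Fin n), EuclideanSpace ℝ (Fin n))) :
    lpBlock χ j (pressure u) = (pressureBlock χ j u).toLp 2 := by
  have hs : ∀ (t : Finset (Fin n)) (f : Fin n → 𝓢(EuclideanSpace ℝ (Fin n), ℂ)),
      (∑ i ∈ t, f i).toLp 2 = ∑ i ∈ t, (f i).toLp 2 volume := fun t f =>
    map_sum (SchwartzMap.toLpCLM ℂ (E := EuclideanSpace ℝ (Fin n)) ℂ 2 volume) f t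
  rw [lpBlock, pressure, pressureBlock, fourierMult_sum, hs]
  refine Finset.sum_congr rfl fun l _ => ?_
  rw [fourierMult_sum, hs]
  refine Finset.sum_congr rfl fun k _ => ?_
  rw [fourierMult_fourierMult _ _ (χ.memLp_symbol_mul_pressureSymbol j l k),
    fourierMult_toLp _ (χ.hasTemperateGrowth_symbol_mul_pressureSymbol j l k)]

lemma le_blockNorm_pressure (χ : LPCutoff n) (s : ℝ) (j : ℤ)
    (u : 𝓢(EuclideanSpace ℝ (Fin n), EuclideanSpace ℝ (Fin n))) :
    ENNReal.ofReal (2 ^ ((j : ℝ) * s) * ‖pressureBlock χ j u 0‖) ≤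
      blockNorm χ s j (pressure u) := by
  rw [blockNorm, ENNReal.ofReal_mul (by positivity), lpBlock_pressure]
  gcongr
  exact norm_le_eLpNorm_top_schwartz _ _

/-- Fourier inversion at the origin is plain integration, and products become convolutions. The
factor `ζ_l ζ_k` of the symbol then contracts `ζ` with each of the two convolved fields. -/
lemma pressureBlock_zero (χ : LPCutoff n) (j : ℤ)
    {u : 𝓢(EuclideanSpace ℝ (Fin n), EuclideanSpace ℝ (Fin n))}
    {H : 𝓢(EuclideanSpace ℝ (Fin n), EuclideanSpace ℂ (Fin n))}
    (hu : SchwartzMap.postcompCLM (complexify n) u = 𝓕⁻ H) :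
    pressureBlock χ j u 0 = -∫ ζ, χ.symbol j ζ * (‖ζ‖ ^ 2 : ℝ)⁻¹ *
      ∫ t, (∑ l, (ζ l : ℂ) * H t l) * ∑ k, (ζ k : ℂ) * H (ζ - t) k := by
  have hsum : ∀ (t : Finset (Fin n)) (f : Fin n → 𝓢(EuclideanSpace ℝ (Fin n), ℂ))
      (x : EuclideanSpace ℝ (Fin n)), (∑ i ∈ t, f i) x = ∑ i ∈ t, f i x := fun t f x => by
    simp
  set G : Fin n → 𝓢(EuclideanSpace ℝ (Fin n), ℂ) := fun k =>
    SchwartzMap.postcompCLM (EuclideanSpace.proj k : _ →L[ℂ] ℂ) H with hG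
  have hc : ∀ (l k : Fin n) (ζ : EuclideanSpace ℝ (Fin n)),
      SchwartzMap.smulLeftCLM ℂ (fun ζ => χ.symbol j ζ * pressureSymbol l k ζ)
        (𝓕 (SchwartzMap.pairing (ContinuousLinearMap.mul ℂ ℂ) (component u l) (component u k))) ζ =
      χ.symbol j ζ * pressureSymbol l k ζ * ∫ t, H t l * H (ζ - t) k := by
    intro l k ζ
    rw [SchwartzMap.smulLeftCLM_apply_apply
      (χ.hasTemperateGrowth_symbol_mul_pressureSymbol j l k), component_eq hu, component_eq hu,
      fourier_pairing_fourierInv, smul_eq_mul]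
    rfl
  have hint : ∀ (l k : Fin n) (ζ : EuclideanSpace ℝ (Fin n)),
      Integrable fun t => H t l * H (ζ - t) k := by
    intro l k ζ
    refine ((G l).integrable (μ := volume)).mul_bdd (c := SchwartzMap.seminorm ℝ 0 0 (G k)) ?_ ?_
    · exact ((G k).continuous.comp (by fun_prop : Continuous fun t => ζ - t)).aestronglyMeasurable
    · exact Filter.Eventually.of_forall fun t => SchwartzMap.norm_le_seminorm ℝ (G k) _
  rw [pressureBlock, hsum]
  simp_rw [hsum, fourierInv_zero_apply]
  rw [Finset.sum_congr rfl fun l _ => (integral_finsetSum _ fun k _ =>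
    SchwartzMap.integrable _).symm, ← integral_finsetSum _ fun l _ => integrable_finsetSum _
      fun k _ => SchwartzMap.integrable _, ← integral_neg]
  congr 1
  ext ζ
  simp_rw [hc, Finset.sum_mul_sum]
  have hint' : ∀ l k, Integrable fun t => (ζ l : ℂ) * H t l * ((ζ k : ℂ) * H (ζ - t) k) := by
    refine fun l k => ((hint l k ζ).const_mul ((ζ l : ℂ) * ζ k)).congr
      (Filter.Eventually.of_forall fun t => ?_)
    ring
  rw [integral_finsetSum _ fun l _ => integrable_finsetSum _ fun k _ => hint' l k, Finset.mul_sum,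
    ← Finset.sum_neg_distrib]
  refine Finset.sum_congr rfl fun l _ => ?_
  rw [integral_finsetSum _ fun k _ => hint' l k, Finset.mul_sum, ← Finset.sum_neg_distrib]
  refine Finset.sum_congr rfl fun k _ => ?_
  have : ∀ t, (ζ l : ℂ) * H t l * ((ζ k : ℂ) * H (ζ - t) k) =
    ((ζ l : ℂ) * ζ k) * (H t l * H (ζ - t) k) := fun t => by ring
  simp_rw [this, integral_const_mul, pressureSymbol]
  push_cast
  ring

/-! ### Planar profiles and the pressure form -/

/-- The rotation by a right angle in the coordinate plane `(a, b)`, composed with the projection. -/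
def rot (a b : Fin n) (ζ : EuclideanSpace ℝ (Fin n)) : EuclideanSpace ℝ (Fin n) :=
  ζ a • EuclideanSpace.single b 1 - ζ b • EuclideanSpace.single a 1

/-- The planar cross product in the coordinate plane `(a, b)`. -/
def cross (a b : Fin n) (x y : EuclideanSpace ℝ (Fin n)) : ℝ := x a * y b - x b * y a

lemma contDiff_rot (a b : Fin n) : ContDiff ℝ ∞ (rot a b) := by
  unfold rot
  fun_prop

lemma rot_neg (a b : Fin n) (ζ : EuclideanSpace ℝ (Fin n)) : rot a b (-ζ) = -rot a b ζ := by
  simp only [rot, PiLp.neg_apply, neg_smul]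
  abel

lemma inner_rot (a b : Fin n) (x y : EuclideanSpace ℝ (Fin n)) :
    ∑ k, x k * rot a b y k = cross a b y x := by
  simp only [rot, cross, PiLp.sub_apply, PiLp.smul_apply, PiLp.single_apply, smul_eq_mul,
    mul_ite, mul_one, mul_zero, mul_sub, Finset.sum_sub_distrib, Finset.sum_ite_eq',
    Finset.mem_univ, if_true]
  ring

lemma cross_self (a b : Fin n) (x : EuclideanSpace ℝ (Fin n)) : cross a b x x = 0 := by
  simp [cross, mul_comm]

lemma cross_sub_self (a b : Fin n) (t ζ : EuclideanSpace ℝ (Fin n)) :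
    cross a b (ζ - t) ζ = -cross a b t ζ := by
  simp only [cross, PiLp.sub_apply]; ring

lemma cross_smul_smul (a b : Fin n) (r : ℝ) (x y : EuclideanSpace ℝ (Fin n)) :
    cross a b (r • x) (r • y) = r ^ 2 * cross a b x y := by
  simp only [cross, PiLp.smul_apply, smul_eq_mul]; ring

lemma cross_add_right_self (a b : Fin n) (x y : EuclideanSpace ℝ (Fin n)) :
    cross a b x (y + x) = cross a b x y := by
  simp only [cross, PiLp.add_apply]; ring

lemma norm_rot_le {a b : Fin n} (hab : a ≠ b) (ζ : EuclideanSpace ℝ (Fin n)) :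
    ‖rot a b ζ‖ ≤ ‖ζ‖ := by
  rw [EuclideanSpace.norm_eq, EuclideanSpace.norm_eq]
  apply Real.sqrt_le_sqrt
  have h : ∀ k, ‖rot a b ζ k‖ ^ 2 =
      (if k = b then ζ a ^ 2 else 0) + if k = a then ζ b ^ 2 else 0 := by
    intro k
    rw [Real.norm_eq_abs, sq_abs]
    by_cases h1 : k = b <;> by_cases h2 : k = a
    · exact absurd (h2.symm.trans h1) hab
    all_goals simp [rot, h1, h2, hab, hab.symm]
  simp_rw [h, Finset.sum_add_distrib]
  simp only [Finset.sum_ite_eq', Finset.mem_univ, if_true, Real.norm_eq_abs, sq_abs]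
  rw [← Finset.sum_pair (f := fun k => ζ k ^ 2) hab]
  exact Finset.sum_le_sum_of_subset_of_nonneg (Finset.subset_univ _) fun _ _ _ => sq_nonneg _

/-- The quadratic form giving the value at the origin of the frequency-localized pressure. -/
def pressureForm (χ : LPCutoff n) (a b : Fin n) (r : ℝ) (g : EuclideanSpace ℝ (Fin n) → ℝ) : ℝ :=
  ∫ ζ, χ.annulus (r • ζ) * (‖ζ‖ ^ 2)⁻¹ * ∫ t, cross a b t ζ ^ 2 * (g t * g (ζ - t))

/-- For the field `i g(ζ) rot ζ`, orthogonality of `rot ζ` to `ζ` gives zero divergence; evenness of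
`g` and oddness of `rot` give a real field. In the pressure, the sign from `(ζ - t) × ζ = -(t × ζ)`
cancels the one from `i² = -1`, leaving the square `(t × ζ)²`. -/
lemma exists_velocity_of_profile (χ : LPCutoff n) {a b : Fin n} (hab : a ≠ b)
    {g : EuclideanSpace ℝ (Fin n) → ℝ} (hg : ContDiff ℝ ∞ g) (hc : HasCompactSupport g)
    (heven : ∀ ζ, g (-ζ) = g ζ) :
    ∃ u : 𝓢(EuclideanSpace ℝ (Fin n), EuclideanSpace ℝ (Fin n)), IsDivFree u ∧
      (∀ (s : ℝ) (j : ℤ), blockNorm χ s j (velocityL2 u) ≤ ENNReal.ofReal (2 ^ ((j : ℝ) * s) *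
        ∫ ζ, |χ.annulus (((2 : ℝ) ^ (-j) * (2 * Real.pi)) • ζ)| * (‖ζ‖ * |g ζ|))) ∧
      eLpNorm u 2 volume ≤ ENNReal.ofReal (√(∫ ζ, (‖ζ‖ * g ζ) ^ 2)) ∧
      ∀ (s : ℝ) (j : ℤ), ENNReal.ofReal (2 ^ ((j : ℝ) * s) *
        pressureForm χ a b ((2 : ℝ) ^ (-j) * (2 * Real.pi)) g) ≤ blockNorm χ s j (pressure u) := by
  have hHc : HasCompactSupport
      fun ζ => ((g ζ : ℂ) * Complex.I) • complexify n (rot a b ζ) := by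
    refine HasCompactSupport.intro hc fun ζ hζ => ?_
    simp [image_eq_zero_of_notMem_tsupport hζ]
  have hHs : ContDiff ℝ ∞ fun ζ => ((g ζ : ℂ) * Complex.I) • complexify n (rot a b ζ) :=
    ((Complex.ofRealCLM.contDiff.comp hg).mul contDiff_const).smul
      ((complexify n).contDiff.comp (contDiff_rot a b))
  set H := hHc.toSchwartzMap hHs with hHdef
  have hH : ∀ ζ, H ζ = ((g ζ : ℂ) * Complex.I) • complexify n (rot a b ζ) := fun ζ => rfl
  have hHk : ∀ ζ k, H ζ k = (g ζ : ℂ) * Complex.I * (rot a b ζ k : ℝ) := fun ζ k => rfl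
  have hdot : ∀ ζ t : EuclideanSpace ℝ (Fin n),
      ∑ k, (ζ k : ℂ) * H t k = (g t : ℂ) * Complex.I * (cross a b t ζ : ℝ) := by
    intro ζ t
    rw [← inner_rot, Complex.ofReal_sum, Finset.mul_sum]
    refine Finset.sum_congr rfl fun k _ => ?_
    rw [hHk]; push_cast; ring
  have hn : ∀ ζ, ‖H ζ‖ ≤ ‖ζ‖ * |g ζ| := by
    intro ζ
    rw [hH, norm_smul, norm_mul, Complex.norm_I, mul_one, Complex.norm_real, norm_complexify,
      mul_comm, Real.norm_eq_abs]
    gcongr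
    exact norm_rot_le hab ζ
  obtain ⟨u, hdiv, hu⟩ := exists_velocity H (fun ζ k => by
      rw [hHk, hHk, heven, rot_neg]; simp) (fun ζ => by rw [hdot, cross_self]; simp)
  have hsym : ∀ j ζ, χ.symbol j ζ =
      (χ.annulus (((2 : ℝ) ^ (-j) * (2 * Real.pi)) • ζ) : ℝ) := fun j ζ => by
    rw [LPCutoff.symbol, smul_smul]
  refine ⟨u, hdiv, fun s j => ?_, ?_, fun s j => ?_⟩
  · refine (blockNorm_velocityL2_le χ s j hu).trans (ENNReal.ofReal_le_ofReal ?_)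
    gcongr 2 ^ ((j : ℝ) * s) * ?_
    have hac : Continuous χ.annulus := χ.contDiff_annulus.continuous
    have hgc : Continuous g := hg.continuous
    refine integral_mono_of_nonneg (Filter.Eventually.of_forall fun ζ => by positivity) ?_
      (Filter.Eventually.of_forall fun ζ => ?_)
    · refine Continuous.integrable_of_hasCompactSupport (by fun_prop) ?_
      exact HasCompactSupport.intro hc fun ζ hζ => by
        simp [image_eq_zero_of_notMem_tsupport hζ]
    · simp only [hsym, Complex.norm_real, Real.norm_eq_abs]
      gcongr
      exact hn ζ
  · rw [eLpNorm_velocity_eq hu]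
    refine ENNReal.ofReal_le_ofReal (Real.sqrt_le_sqrt ?_)
    have hgc : Continuous g := hg.continuous
    refine integral_mono_of_nonneg (Filter.Eventually.of_forall fun ζ => by positivity) ?_
      (Filter.Eventually.of_forall fun ζ => ?_)
    · refine Continuous.integrable_of_hasCompactSupport (by fun_prop) ?_
      exact HasCompactSupport.intro hc fun ζ hζ => by
        simp [image_eq_zero_of_notMem_tsupport hζ]
    · simp only
      rw [← sq_abs (‖ζ‖ * g ζ), abs_mul, abs_norm]
      gcongr
      exact hn ζ
  · refine le_trans (ENNReal.ofReal_le_ofReal ?_) (le_blockNorm_pressure χ s j u)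
    gcongr 2 ^ ((j : ℝ) * s) * ?_
    have hval : pressureBlock χ j u 0 =
        ((-pressureForm χ a b ((2 : ℝ) ^ (-j) * (2 * Real.pi)) g : ℝ) : ℂ) := by
      rw [pressureBlock_zero χ j hu, pressureForm, Complex.ofReal_neg, ← integral_complex_ofReal]
      congr 2
      ext ζ
      rw [hsym, Complex.ofReal_mul, ← integral_complex_ofReal, Complex.ofReal_mul,
        Complex.ofReal_inv]
      congr 2
      ext t
      rw [hdot, hdot, cross_sub_self]
      push_cast
      linear_combination (-(cross a b t ζ : ℂ) ^ 2 * g t * g (ζ - t)) * Complex.I_sq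
    rw [hval, Complex.norm_real, norm_neg]
    exact Real.le_norm_self _

/-! ### Dilation of profiles to high frequency -/

lemma integral_comp_inv_smul' (f : EuclideanSpace ℝ (Fin n) → ℝ) {r : ℝ} (hr : 0 < r) :
    ∫ x, f (r⁻¹ • x) = r ^ n * ∫ x, f x := by
  rw [Measure.integral_comp_inv_smul_of_nonneg _ _ hr.le, finrank_euclideanSpace_fin, smul_eq_mul]

/-- The two integrals give `l^(2n)`, the squared cross product `l^4`, and the factor `‖ζ‖⁻²` gives
`l⁻²`. -/
lemma pressureForm_comp_inv_smul (χ : LPCutoff n) (a b : Fin n) (r : ℝ) {l : ℝ} (hl : 0 < l)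
    (A : ℝ) (g : EuclideanSpace ℝ (Fin n) → ℝ) :
    pressureForm χ a b r (fun ζ => A * g (l⁻¹ • ζ)) =
      (A * l ^ (n + 1)) ^ 2 * pressureForm χ a b (r * l) g := by
  have h1 : ∀ ζ : EuclideanSpace ℝ (Fin n),
      ∫ t, cross a b t ζ ^ 2 * (A * g (l⁻¹ • t) * (A * g (l⁻¹ • (ζ - t)))) =
      l ^ n * (A ^ 2 * l ^ 4 * ∫ t, cross a b t (l⁻¹ • ζ) ^ 2 * (g t * g (l⁻¹ • ζ - t))) := by
    intro ζ
    rw [← integral_const_mul, ← integral_comp_inv_smul' _ hl]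
    congr 1
    ext t
    rw [cross_smul_smul, smul_sub]
    field_simp
  unfold pressureForm
  simp_rw [h1]
  rw [← integral_const_mul]
  have h2 := integral_comp_inv_smul' (n := n) (fun ζ => (χ.annulus ((r * l) • ζ) *
    (‖l • ζ‖ ^ 2)⁻¹ * (l ^ n * (A ^ 2 * l ^ 4 *
      ∫ t, cross a b t ζ ^ 2 * (g t * g (ζ - t)))))) hl
  have h3 : ∀ ζ : EuclideanSpace ℝ (Fin n), (r * l) • l⁻¹ • ζ = r • ζ := fun ζ => by
    rw [smul_smul, mul_assoc, mul_inv_cancel₀ hl.ne', mul_one]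
  simp_rw [h3, smul_inv_smul₀ hl.ne'] at h2
  rw [h2, ← integral_const_mul]
  congr 1
  ext ζ
  rw [norm_smul, Real.norm_of_nonneg hl.le, mul_pow, mul_inv]
  field_simp
  ring

/-- A frequency profile whose rescalings inflate the pressure by more than `M`. -/
structure InflationProfile (χ : LPCutoff n) (a b : Fin n) (σ : ℕ) (M : ℝ) where
  g : EuclideanSpace ℝ (Fin n) → ℝ
  smooth : ContDiff ℝ ∞ g
  compact : HasCompactSupport g
  even : ∀ ζ, g (-ζ) = g ζ
  block_le : ∀ t : ℝ, 0 < t → t ^ σ * ∫ ζ, |χ.annulus (t⁻¹ • ζ)| * (‖ζ‖ * |g ζ|) ≤ 1 / 2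
  j₀ : ℤ
  lt_form : M < (((2 : ℝ) ^ j₀) ^ σ) ^ 2 * pressureForm χ a b ((2 : ℝ) ^ j₀)⁻¹ g

lemma two_rpow_mul_natCast (j : ℤ) (σ : ℕ) :
    (2 : ℝ) ^ ((j : ℝ) * (σ : ℝ)) = ((2 : ℝ) ^ j) ^ σ := by
  rw [Real.rpow_mul_natCast (by norm_num), Real.rpow_intCast]

lemma InflationProfile.exists_velocity {χ : LPCutoff n} {a b : Fin n} (hab : a ≠ b) {σ : ℕ}
    {M : ℝ} (P : InflationProfile χ a b σ M) (hM : 0 ≤ M) (N : ℤ) :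
    ∃ u : 𝓢(EuclideanSpace ℝ (Fin n), EuclideanSpace ℝ (Fin n)), IsDivFree u ∧
      besovNorm χ σ (velocityL2 u) ≤ ENNReal.ofReal (1 / 2) ∧
      eLpNorm u 2 volume ≤ ENNReal.ofReal (1 / 2) ∧
      ∃ j : ℤ, N ≤ j ∧ ENNReal.ofReal M < blockNorm χ (2 * σ) j (pressure u) := by
  have hpi := Real.pi_pos
  set D := ∫ ζ, (‖ζ‖ * P.g ζ) ^ 2 with hD
  -- This makes the dilation factor `l` exceed both `1` and `4D`, as the `L²` bound needs; the
  -- second entry of `m` pushes the inflated block `j₀ + m` beyond `N`.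
  obtain ⟨m₀, hm₀⟩ := pow_unbounded_of_one_lt (2 * Real.pi * max 1 (4 * D))
    (one_lt_two : (1 : ℝ) < 2)
  set m : ℕ := max m₀ (N - P.j₀).toNat with hm
  have hm1 : 2 * Real.pi * max 1 (4 * D) < 2 ^ m :=
    hm₀.trans_le (pow_le_pow_right₀ one_le_two (le_max_left _ _))
  -- Dividing by `2π` absorbs the passage from `ζ` to `ξ`, so the dilated cutoff has an exact power
  -- of two as its scale.
  set l : ℝ := 2 ^ m / (2 * Real.pi) with hl
  have hl1 : max 1 (4 * D) < l := by
    rw [hl, lt_div_iff₀ (by positivity)]; linarith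
  have hl2 : 1 < l := (le_max_left _ _).trans_lt hl1
  have hl3 : 4 * D < l := (le_max_right _ _).trans_lt hl1
  have hl0 : 0 < l := by linarith
  have hm2 : (0 : ℝ) < 2 ^ m := by positivity
  -- With this amplitude the weight `2^(jσ)` becomes `2^((j-m)σ)`: all weighted block quantities are
  -- preserved and only the index shifts by `m`.
  set A : ℝ := (l ^ (n + 1) * (2 ^ m) ^ σ)⁻¹ with hA
  have hA0 : 0 < A := by positivity
  have hAl : A * l ^ (n + 1) = ((2 ^ m) ^ σ)⁻¹ := by
    rw [hA, mul_inv, mul_comm, ← mul_assoc, mul_inv_cancel₀ (by positivity), one_mul]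
  have hscale : ∀ j : ℤ, (2 : ℝ) ^ (-j) * (2 * Real.pi) * l = ((2 : ℝ) ^ (j - m))⁻¹ := by
    intro j
    rw [hl, mul_assoc, mul_div_cancel₀ _ (by positivity), zpow_neg, zpow_sub₀ two_ne_zero,
      zpow_natCast]
    field_simp
  have hpow : ∀ j : ℤ, ((2 : ℝ) ^ j) ^ σ * (((2 : ℝ) ^ m) ^ σ)⁻¹ = ((2 : ℝ) ^ (j - m)) ^ σ := by
    intro j
    rw [zpow_sub₀ two_ne_zero, zpow_natCast, div_pow, div_eq_mul_inv]
  obtain ⟨u, hdiv, hblock, hL2, hp⟩ := exists_velocity_of_profile χ hab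
    (g := fun ζ => A * P.g (l⁻¹ • ζ)) (contDiff_const.mul (P.smooth.comp (contDiff_const_smul _)))
    (HasCompactSupport.mul_left (P.compact.comp_smul (inv_ne_zero hl0.ne')))
    (fun ζ => by rw [smul_neg, P.even])
  refine ⟨u, hdiv, iSup_le fun j => ?_, ?_, P.j₀ + m, ?_, ?_⟩
  · refine (hblock σ j).trans (ENNReal.ofReal_le_ofReal ?_)
    have h1 := integral_comp_inv_smul' (n := n) (fun ζ =>
      |χ.annulus (((2 : ℝ) ^ (-j) * (2 * Real.pi) * l) • ζ)| * (‖l • ζ‖ * |A * P.g ζ|)) hl0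
    have h3 : ∀ ζ : EuclideanSpace ℝ (Fin n), ((2 : ℝ) ^ (-j) * (2 * Real.pi) * l) • l⁻¹ • ζ =
        ((2 : ℝ) ^ (-j) * (2 * Real.pi)) • ζ := fun ζ => by
      rw [smul_smul, mul_assoc _ l, mul_inv_cancel₀ hl0.ne', mul_one]
    simp_rw [h3, smul_inv_smul₀ hl0.ne'] at h1
    rw [h1, hscale]
    have h4 : ∀ ζ : EuclideanSpace ℝ (Fin n), |χ.annulus (((2 : ℝ) ^ (j - m))⁻¹ • ζ)| *
        (‖l • ζ‖ * |A * P.g ζ|) =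
        A * l * (|χ.annulus (((2 : ℝ) ^ (j - m))⁻¹ • ζ)| * (‖ζ‖ * |P.g ζ|)) := by
      intro ζ
      rw [norm_smul, Real.norm_of_nonneg hl0.le, abs_mul, abs_of_pos hA0]; ring
    simp_rw [h4, integral_const_mul]
    refine le_of_eq_of_le ?_ (P.block_le (2 ^ (j - m)) (by positivity))
    rw [two_rpow_mul_natCast, ← hpow, ← hAl]
    ring
  · refine hL2.trans (ENNReal.ofReal_le_ofReal ?_)
    rw [Real.sqrt_le_left (by norm_num)]
    have h1 := integral_comp_inv_smul' (n := n) (fun ζ => (‖l • ζ‖ * (A * P.g ζ)) ^ 2) hl0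
    simp_rw [smul_inv_smul₀ hl0.ne'] at h1
    have h4 : ∀ ζ : EuclideanSpace ℝ (Fin n), (‖l • ζ‖ * (A * P.g ζ)) ^ 2 =
        A ^ 2 * l ^ 2 * (‖ζ‖ * P.g ζ) ^ 2 := by
      intro ζ
      rw [norm_smul, Real.norm_of_nonneg hl0.le]; ring
    simp_rw [h1, h4, integral_const_mul]
    rw [← hD]
    have hn : n ≠ 0 := fun h => by subst h; exact a.elim0
    have h5 : l ≤ l ^ n := le_self_pow₀ hl2.le hn
    have h6 : (A * l ^ (n + 1)) ^ 2 ≤ 1 := by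
      rw [hAl]
      have : (1 : ℝ) ≤ (2 ^ m) ^ σ := one_le_pow₀ (one_le_pow₀ one_le_two)
      exact pow_le_one₀ (by positivity) (inv_le_one_of_one_le₀ this)
    -- The bound for the squared `L²` norm is `(A l^(n+1))² D / l^n`, at most `D / l < 1/4`.
    have h7 : l ^ n * (A ^ 2 * l ^ 2 * D) * l ^ n = (A * l ^ (n + 1)) ^ 2 * D := by ring
    have hD0 : 0 ≤ D := integral_nonneg fun ζ => sq_nonneg _
    have h8 : l ^ n * (A ^ 2 * l ^ 2 * D) * l ^ n ≤ D := by
      rw [h7]; exact mul_le_of_le_one_left hD0 h6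
    have h9 : 0 ≤ l ^ n * (A ^ 2 * l ^ 2 * D) := by positivity
    by_contra hcon
    push Not at hcon
    nlinarith
  · have := Int.self_le_toNat (N - P.j₀)
    have h2 : ((N - P.j₀).toNat : ℤ) ≤ m := by exact_mod_cast le_max_right _ _
    linarith
  · refine lt_of_lt_of_le ?_ (hp (2 * σ) (P.j₀ + m))
    have h1 : (2 : ℝ) ^ (((P.j₀ + m : ℤ) : ℝ) * (2 * σ)) =
        (((2 : ℝ) ^ (P.j₀ + m : ℤ)) ^ σ) ^ 2 := by
      have := two_rpow_mul_natCast (P.j₀ + m) (σ * 2)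
      rw [← pow_mul, ← this]
      congr 1
      push_cast; ring
    have h2 : (2 : ℝ) ^ (((P.j₀ + m : ℤ) : ℝ) * (2 * σ)) *
        pressureForm χ a b ((2 : ℝ) ^ (-(P.j₀ + m : ℤ)) * (2 * Real.pi))
          (fun ζ => A * P.g (l⁻¹ • ζ)) =
        (((2 : ℝ) ^ P.j₀) ^ σ) ^ 2 * pressureForm χ a b ((2 : ℝ) ^ P.j₀)⁻¹ P.g := by
      rw [pressureForm_comp_inv_smul _ _ _ _ hl0, hscale, hAl, h1, ← mul_assoc, ← mul_pow, hpow,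
        add_sub_cancel_right]
    rw [h2]
    exact (ENNReal.ofReal_lt_ofReal_iff (hM.trans_lt P.lt_form)).2 P.lt_form

/-! ### Lower bounds for the pressure form -/

/-- The kernel of `pressureForm`. -/
def pressureKernel (χ : LPCutoff n) (r : ℝ) (ζ : EuclideanSpace ℝ (Fin n)) : ℝ :=
  χ.annulus (r • ζ) * (‖ζ‖ ^ 2)⁻¹

lemma continuous_pressureKernel (χ : LPCutoff n) (r : ℝ) : Continuous (pressureKernel χ r) := by
  have hac : Continuous χ.annulus := χ.contDiff_annulus.continuous
  rw [continuous_iff_continuousAt]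
  intro ζ
  by_cases h : ζ = 0
  · subst h
    refine (continuousAt_const (y := (0 : ℝ))).congr ?_
    have hc : Continuous fun ζ : EuclideanSpace ℝ (Fin n) => ‖r • ζ‖ := by fun_prop
    filter_upwards [hc.continuousAt.eventually_lt (continuousAt_const (y := (1 / 2 : ℝ)))
      (by simp)] with ζ hζ
    rw [pressureKernel, χ.annulus_eq_zero_of_le hζ.le, zero_mul]
  · unfold pressureKernel
    have : ‖ζ‖ ^ 2 ≠ 0 := by simpa using h
    fun_prop (disch := assumption)

@[fun_prop]
lemma continuous_cross (a b : Fin n) {X : Type*} [TopologicalSpace X]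
    {f h : X → EuclideanSpace ℝ (Fin n)} (hf : Continuous f) (hh : Continuous h) :
    Continuous fun x => cross a b (f x) (h x) := by
  unfold cross
  fun_prop

lemma integrable_pressureKernel_mul (χ : LPCutoff n) (a b : Fin n) (r : ℝ)
    {g : EuclideanSpace ℝ (Fin n) → ℝ} (hg : Continuous g) (hc : HasCompactSupport g) :
    Integrable (fun z : EuclideanSpace ℝ (Fin n) × EuclideanSpace ℝ (Fin n) =>
      pressureKernel χ r (z.2 + z.1) * (cross a b z.1 z.2 ^ 2 * (g z.1 * g z.2)))
      (volume.prod volume) := by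
  have hk := continuous_pressureKernel χ r
  refine Continuous.integrable_of_hasCompactSupport (by fun_prop) ?_
  refine HasCompactSupport.intro (hc.isCompact.prod hc.isCompact) fun z hz => ?_
  rw [Set.mem_prod, not_and_or] at hz
  rcases hz with hz | hz <;> simp [image_eq_zero_of_notMem_tsupport hz]

/-- Substituting `ζ = y + t` makes the form symmetric in the two interacting frequencies, since `t ×
(y + t) = t × y`. -/
lemma pressureForm_eq_integral_prod (χ : LPCutoff n) (a b : Fin n) (r : ℝ)
    {g : EuclideanSpace ℝ (Fin n) → ℝ} (hg : Continuous g) (hc : HasCompactSupport g) :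
    pressureForm χ a b r g =
      ∫ z : EuclideanSpace ℝ (Fin n) × EuclideanSpace ℝ (Fin n),
        pressureKernel χ r (z.2 + z.1) * (cross a b z.1 z.2 ^ 2 * (g z.1 * g z.2))
        ∂(volume.prod volume) := by
  have hk := continuous_pressureKernel χ r
  rw [integral_prod _ (integrable_pressureKernel_mul χ a b r hg hc), pressureForm]
  simp_rw [← integral_const_mul]
  rw [integral_integral_swap_of_hasCompactSupport]
  · congr 1
    ext t
    rw [← integral_add_right_eq_self _ t]
    congr 1
    ext y
    rw [cross_add_right_self, add_sub_cancel_right, pressureKernel]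
  · exact (hk.comp continuous_fst).mul (by fun_prop)
  · refine HasCompactSupport.intro ((hc.isCompact.add hc.isCompact).prod hc.isCompact)
      fun z hz => ?_
    by_contra hne
    have h0 : g z.2 * g (z.1 - z.2) ≠ 0 := fun h0 => hne (by
      change _ * (_ * (g z.2 * g (z.1 - z.2))) = 0
      rw [h0, mul_zero, mul_zero])
    have h1 : z.2 ∈ tsupport g := subset_tsupport _ (left_ne_zero_of_mul h0)
    have h2 : z.1 - z.2 ∈ tsupport g := subset_tsupport _ (right_ne_zero_of_mul h0)
    exact hz ⟨⟨_, h1, _, h2, add_sub_cancel z.2 z.1⟩, h1⟩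

/-- Since the kernel is nonnegative wherever the profile interacts, `g x * g y` may be replaced by
the smaller sum over `N` chosen pairs of bumps. Each pair then contributes at least `c (∫ B)²`. -/
lemma le_pressureForm (χ : LPCutoff n) (a b : Fin n) (r : ℝ)
    {g B : EuclideanSpace ℝ (Fin n) → ℝ} (hg : Continuous g) (hc : HasCompactSupport g)
    (hB : Continuous B) (hBc : HasCompactSupport B) (hB0 : ∀ x, 0 ≤ B x) (N : ℕ)
    (p p' : ℕ → EuclideanSpace ℝ (Fin n)) (W : ℕ → ℝ) (hW : ∀ k, 0 < W k) (c : ℝ)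
    (h1 : ∀ x y, g x ≠ 0 → g y ≠ 0 → 0 ≤ pressureKernel χ r (y + x))
    (h2 : ∀ x y, ∑ k ∈ Finset.range N, W k * (B (x - p k) * B (y - p' k)) ≤ g x * g y)
    (h3 : ∀ k ∈ Finset.range N, ∀ x y, B (x - p k) ≠ 0 → B (y - p' k) ≠ 0 →
      c ≤ W k * (pressureKernel χ r (y + x) * cross a b x y ^ 2)) :
    N * c * (∫ x, B x) ^ 2 ≤ pressureForm χ a b r g := by
  have hBi : ∀ q, Integrable fun x => B (x - q) := fun q =>
    (hB.integrable_of_hasCompactSupport hBc).comp_sub_right q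
  have hi : ∀ k ∈ Finset.range N,
      Integrable (fun z : EuclideanSpace ℝ (Fin n) × EuclideanSpace ℝ (Fin n) =>
        c * (B (z.1 - p k) * B (z.2 - p' k))) (volume.prod volume) := fun k _ =>
    ((hBi _).mul_prod (hBi _)).const_mul c
  have hl : ∫ z : EuclideanSpace ℝ (Fin n) × EuclideanSpace ℝ (Fin n),
      ∑ k ∈ Finset.range N, c * (B (z.1 - p k) * B (z.2 - p' k)) ∂(volume.prod volume) =
      N * c * (∫ x, B x) ^ 2 := by
    rw [integral_finsetSum _ hi]
    simp_rw [integral_const_mul]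
    rw [Finset.sum_congr rfl fun k _ => by
      rw [integral_prod_mul (fun x => B (x - p k)) (fun x => B (x - p' k)),
        integral_sub_right_eq_self, integral_sub_right_eq_self]]
    simp
    ring
  rw [pressureForm_eq_integral_prod χ a b r hg hc, ← hl]
  refine integral_mono (integrable_finsetSum _ hi) (integrable_pressureKernel_mul χ a b r hg hc) ?_
  rintro ⟨x, y⟩
  simp only
  have hnn : ∀ k, 0 ≤ B (x - p k) * B (y - p' k) := fun k => mul_nonneg (hB0 _) (hB0 _)
  -- Here the sign of the kernel is not known, but `h2` forces every chosen product of bumps to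
  -- vanish too.
  by_cases hxy : g x * g y = 0
  · have hs := h2 x y
    rw [hxy] at hs ⊢
    have hz := (Finset.sum_eq_zero_iff_of_nonneg fun k _ => mul_nonneg (hW k).le (hnn k)).1
      (hs.antisymm (Finset.sum_nonneg fun k _ => mul_nonneg (hW k).le (hnn k)))
    rw [Finset.sum_eq_zero, mul_zero, mul_zero]
    intro k hk
    rw [(mul_eq_zero.1 (hz k hk)).resolve_left (hW k).ne', mul_zero]
  · have hK := mul_nonneg (h1 x y (left_ne_zero_of_mul hxy) (right_ne_zero_of_mul hxy))
      (sq_nonneg (cross a b x y))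
    rw [← mul_assoc]
    refine le_trans ?_ (mul_le_mul_of_nonneg_left (h2 x y) hK)
    rw [Finset.mul_sum]
    refine Finset.sum_le_sum fun k hk => ?_
    by_cases hz : B (x - p k) * B (y - p' k) = 0
    · rw [hz]; simp
    · have := mul_le_mul_of_nonneg_right
        (h3 k hk x y (left_ne_zero_of_mul hz) (right_ne_zero_of_mul hz)) (hnn k)
      linarith

/-! ### Even bumps, lacunary sums and their block masses -/

/-- A fixed smooth bump supported in the ball of radius `1/16`. -/
def bump (n : ℕ) : ContDiffBump (0 : EuclideanSpace ℝ (Fin n)) :=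
  ⟨1 / 32, 1 / 16, by norm_num, by norm_num⟩

/-- The sum of the bumps centred at `q` and `-q`. -/
def evenBump (q ζ : EuclideanSpace ℝ (Fin n)) : ℝ := bump n (ζ - q) + bump n (ζ + q)

lemma bump_nonneg (x : EuclideanSpace ℝ (Fin n)) : 0 ≤ bump n x := (bump n).nonneg

lemma norm_lt_of_bump_ne_zero {x : EuclideanSpace ℝ (Fin n)} (h : bump n x ≠ 0) :
    ‖x‖ < 1 / 16 := by
  have : x ∈ Function.support (bump n) := h
  rwa [(bump n).support_eq, mem_ball_zero_iff] at this

lemma evenBump_nonneg (q ζ : EuclideanSpace ℝ (Fin n)) : 0 ≤ evenBump q ζ :=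
  add_nonneg (bump_nonneg _) (bump_nonneg _)

lemma bump_sub_le_evenBump (q ζ : EuclideanSpace ℝ (Fin n)) : bump n (ζ - q) ≤ evenBump q ζ :=
  le_add_of_nonneg_right (bump_nonneg _)

lemma bump_add_le_evenBump (q ζ : EuclideanSpace ℝ (Fin n)) : bump n (ζ + q) ≤ evenBump q ζ :=
  le_add_of_nonneg_left (bump_nonneg _)

lemma evenBump_neg (q ζ : EuclideanSpace ℝ (Fin n)) : evenBump q (-ζ) = evenBump q ζ := by
  have h : ∀ x, bump n (-x) = bump n x := (bump n).neg
  rw [evenBump, evenBump, ← h (-ζ - q), ← h (-ζ + q), add_comm]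
  congr 2 <;> abel

lemma contDiff_evenBump (q : EuclideanSpace ℝ (Fin n)) : ContDiff ℝ ∞ (evenBump q) :=
  ((bump n).contDiff.comp (contDiff_id.sub contDiff_const)).add
    ((bump n).contDiff.comp (contDiff_id.add contDiff_const))

lemma of_evenBump_ne_zero {q ζ : EuclideanSpace ℝ (Fin n)} (h : evenBump q ζ ≠ 0) :
    ‖ζ - q‖ < 1 / 16 ∨ ‖ζ + q‖ < 1 / 16 := by
  by_cases h1 : bump n (ζ - q) = 0
  · right
    apply norm_lt_of_bump_ne_zero
    intro h2
    exact h (by rw [evenBump, h1, h2, add_zero])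
  · exact Or.inl (norm_lt_of_bump_ne_zero h1)

lemma abs_norm_sub_norm_lt_of_evenBump_ne_zero {q ζ : EuclideanSpace ℝ (Fin n)}
    (h : evenBump q ζ ≠ 0) : |‖ζ‖ - ‖q‖| < 1 / 16 := by
  rcases of_evenBump_ne_zero h with h | h
  · exact (abs_norm_sub_norm_le _ _).trans_lt h
  · have := abs_norm_sub_norm_le ζ (-q)
    rw [norm_neg, sub_neg_eq_add] at this
    exact this.trans_lt h

lemma hasCompactSupport_evenBump (q : EuclideanSpace ℝ (Fin n)) :
    HasCompactSupport (evenBump q) := by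
  refine HasCompactSupport.intro (isCompact_closedBall 0 (‖q‖ + 1 / 16)) fun ζ hζ => ?_
  by_contra h
  have := abs_lt.1 (abs_norm_sub_norm_lt_of_evenBump_ne_zero h)
  rw [mem_closedBall_zero_iff] at hζ
  linarith

lemma integral_evenBump (q : EuclideanSpace ℝ (Fin n)) :
    ∫ ζ, evenBump q ζ = 2 * ∫ ζ, bump n ζ := by
  have hi : Integrable (bump n) volume := (bump n).integrable
  unfold evenBump
  rw [integral_add (hi.comp_sub_right q) (hi.comp_add_right q),
    integral_sub_right_eq_self (fun x => bump n x),
    integral_add_right_eq_self (fun x => bump n x), two_mul]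

/-- The weighted `L¹` size of the part of `‖ζ‖ g(ζ)` seen by the block at frequency `t`. -/
def blockMass (χ : LPCutoff n) (σ : ℕ) (t : ℝ) (g : EuclideanSpace ℝ (Fin n) → ℝ) : ℝ :=
  t ^ σ * ∫ ζ, |χ.annulus (t⁻¹ • ζ)| * (‖ζ‖ * |g ζ|)

lemma integrable_blockMass (χ : LPCutoff n) (t : ℝ) {g : EuclideanSpace ℝ (Fin n) → ℝ}
    (hg : Continuous g) (hc : HasCompactSupport g) :
    Integrable fun ζ => |χ.annulus (t⁻¹ • ζ)| * (‖ζ‖ * |g ζ|) := by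
  have hac : Continuous χ.annulus := χ.contDiff_annulus.continuous
  refine Continuous.integrable_of_hasCompactSupport (by fun_prop) ?_
  exact HasCompactSupport.intro hc fun ζ hζ => by simp [image_eq_zero_of_notMem_tsupport hζ]

lemma blockMass_add_le (χ : LPCutoff n) (σ : ℕ) {t : ℝ} (ht : 0 < t)
    {f g : EuclideanSpace ℝ (Fin n) → ℝ} (hf : Continuous f) (hfc : HasCompactSupport f)
    (hg : Continuous g) (hgc : HasCompactSupport g) :
    blockMass χ σ t (fun ζ => f ζ + g ζ) ≤ blockMass χ σ t f + blockMass χ σ t g := by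
  rw [blockMass, blockMass, blockMass, ← mul_add, ← integral_add (integrable_blockMass χ t hf hfc)
    (integrable_blockMass χ t hg hgc)]
  refine mul_le_mul_of_nonneg_left ?_ (by positivity)
  refine integral_mono (integrable_blockMass χ t (g := fun ζ => f ζ + g ζ) (hf.add hg)
    (hfc.add hgc)) ((integrable_blockMass χ t hf hfc).add (integrable_blockMass χ t hg hgc))
    fun ζ => ?_
  simp only
  rw [← mul_add, ← mul_add]
  gcongr
  exact abs_add_le _ _

lemma blockMass_const_mul (χ : LPCutoff n) (σ : ℕ) (t : ℝ) {c : ℝ} (hc : 0 ≤ c)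
    (g : EuclideanSpace ℝ (Fin n) → ℝ) :
    blockMass χ σ t (fun ζ => c * g ζ) = c * blockMass χ σ t g := by
  have : ∀ ζ, |χ.annulus (t⁻¹ • ζ)| * (‖ζ‖ * |c * g ζ|) =
      c * (|χ.annulus (t⁻¹ • ζ)| * (‖ζ‖ * |g ζ|)) := fun ζ => by
    rw [abs_mul, abs_of_nonneg hc]; ring
  simp_rw [blockMass, this, integral_const_mul]
  ring

lemma of_annulus_ne_zero (χ : LPCutoff n) {t : ℝ} (ht : 0 < t) {ζ : EuclideanSpace ℝ (Fin n)}
    (h : χ.annulus (t⁻¹ • ζ) ≠ 0) : t / 2 < ‖ζ‖ ∧ ‖ζ‖ ≤ 7 / 6 * t := by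
  have hn : ‖t⁻¹ • ζ‖ = ‖ζ‖ / t := by
    rw [norm_smul, norm_inv, Real.norm_of_nonneg ht.le, div_eq_inv_mul]
  constructor
  · by_contra hcon
    refine h (χ.annulus_eq_zero_of_le ?_)
    rw [hn, div_le_iff₀ ht]; linarith
  · by_contra hcon
    refine h (χ.annulus_eq_zero_of_lt ?_)
    rw [hn, lt_div_iff₀ ht]; linarith

/-- Where the integrand is nonzero, `‖ζ‖ ≤ 2R` and hence `t ≤ 4R`. The weights cost `(4R)^σ · 2R`,
and the two bumps supply another factor `2`. -/
lemma blockMass_evenBump_le (χ : LPCutoff n) {C : ℝ} (hC : ∀ ξ, |χ.annulus ξ| ≤ C) (σ : ℕ)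
    {t : ℝ} (ht : 0 < t) {q : EuclideanSpace ℝ (Fin n)} {R : ℝ} (hR : ‖q‖ + 1 / 16 ≤ 2 * R) :
    blockMass χ σ t (evenBump q) ≤ 4 ^ (σ + 1) * C * (∫ ζ, bump n ζ) * R ^ (σ + 1) := by
  have hC0 : 0 ≤ C := (abs_nonneg _).trans (hC 0)
  have hR0 : 0 ≤ R := by linarith [norm_nonneg q]
  rw [blockMass, ← integral_const_mul]
  have hE : Integrable (evenBump q) :=
    (contDiff_evenBump q).continuous.integrable_of_hasCompactSupport (hasCompactSupport_evenBump q)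
  have hle : ∫ ζ, t ^ σ * (|χ.annulus (t⁻¹ • ζ)| * (‖ζ‖ * |evenBump q ζ|)) ≤
      ∫ ζ, C * (4 * R) ^ σ * (2 * R) * evenBump q ζ := by
    refine integral_mono ((integrable_blockMass χ t (contDiff_evenBump q).continuous
      (hasCompactSupport_evenBump q)).const_mul _) (hE.const_mul _) fun ζ => ?_
    have h0 := evenBump_nonneg q ζ
    by_cases h1 : evenBump q ζ = 0
    · simp [h1]
    by_cases h2 : χ.annulus (t⁻¹ • ζ) = 0
    · simp only [h2, abs_zero, zero_mul, mul_zero]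
      positivity
    have h3 := of_annulus_ne_zero χ ht h2
    have h4 := abs_lt.1 (abs_norm_sub_norm_lt_of_evenBump_ne_zero h1)
    simp only [abs_of_nonneg h0]
    calc t ^ σ * (|χ.annulus (t⁻¹ • ζ)| * (‖ζ‖ * evenBump q ζ))
        ≤ (4 * R) ^ σ * (C * ((2 * R) * evenBump q ζ)) := by
          gcongr
          · linarith
          · exact hC _
          · linarith
      _ = _ := by ring
  refine hle.trans_eq ?_
  rw [integral_const_mul, integral_evenBump]
  ring

lemma of_blockMass_evenBump_ne_zero (χ : LPCutoff n) (σ : ℕ) {t : ℝ} (ht : 0 < t)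
    {q : EuclideanSpace ℝ (Fin n)} (h : blockMass χ σ t (evenBump q) ≠ 0) :
    t / 2 < ‖q‖ + 1 / 16 ∧ ‖q‖ < 7 / 6 * t + 1 / 16 := by
  by_contra hcon
  refine h ?_
  rw [blockMass, integral_eq_zero_of_ae, mul_zero]
  refine Filter.Eventually.of_forall fun ζ => ?_
  by_contra hne
  have h1 : evenBump q ζ ≠ 0 := fun h1 => hne (by simp [h1])
  have h2 : χ.annulus (t⁻¹ • ζ) ≠ 0 := fun h2 => hne (by simp [h2])
  have h3 := of_annulus_ne_zero χ ht h2
  have h4 := abs_lt.1 (abs_norm_sub_norm_lt_of_evenBump_ne_zero h1)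
  exact hcon ⟨by linarith, by linarith⟩

lemma sum_le_of_pairwise_eq_zero {ι : Type*} (s : Finset ι) (f : ι → ℝ) {K : ℝ}
    (hK : 0 ≤ K) (hf : ∀ i ∈ s, f i ≤ K)
    (h : ∀ i ∈ s, ∀ j ∈ s, f i ≠ 0 → f j ≠ 0 → i = j) : ∑ i ∈ s, f i ≤ K := by
  by_cases h0 : ∃ i ∈ s, f i ≠ 0
  · obtain ⟨i, hi, hfi⟩ := h0
    rw [Finset.sum_eq_single_of_mem i hi fun j hj hji => ?_]
    · exact hf i hi
    · by_contra hfj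
      exact hji (h j hj i hi hfj hfi)
  · push Not at h0
    rwa [Finset.sum_eq_zero h0]

/-- A finite lacunary superposition of even bumps. -/
def lacunary (σ N : ℕ) (q : ℕ → EuclideanSpace ℝ (Fin n)) (ζ : EuclideanSpace ℝ (Fin n)) : ℝ :=
  ∑ k ∈ Finset.range N, ((4 : ℝ) ^ (k + 1))⁻¹ ^ (σ + 1) * evenBump (q k) ζ

lemma contDiff_lacunary (σ N : ℕ) (q : ℕ → EuclideanSpace ℝ (Fin n)) :
    ContDiff ℝ ∞ (lacunary σ N q) :=
  ContDiff.sum fun k _ => contDiff_const.mul (contDiff_evenBump (q k))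

lemma lacunary_nonneg (σ N : ℕ) (q : ℕ → EuclideanSpace ℝ (Fin n))
    (ζ : EuclideanSpace ℝ (Fin n)) : 0 ≤ lacunary σ N q ζ :=
  Finset.sum_nonneg fun k _ => mul_nonneg (by positivity) (evenBump_nonneg _ _)

lemma lacunary_neg (σ N : ℕ) (q : ℕ → EuclideanSpace ℝ (Fin n))
    (ζ : EuclideanSpace ℝ (Fin n)) : lacunary σ N q (-ζ) = lacunary σ N q ζ := by
  simp only [lacunary, evenBump_neg]

lemma of_lacunary_ne_zero {σ N : ℕ} {q : ℕ → EuclideanSpace ℝ (Fin n)}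
    {ζ : EuclideanSpace ℝ (Fin n)} (h : lacunary σ N q ζ ≠ 0) :
    ∃ k ∈ Finset.range N, evenBump (q k) ζ ≠ 0 := by
  obtain ⟨k, hk, h⟩ := Finset.exists_ne_zero_of_sum_ne_zero h
  exact ⟨k, hk, right_ne_zero_of_mul h⟩

lemma lacunary_succ (σ N : ℕ) (q : ℕ → EuclideanSpace ℝ (Fin n)) :
    lacunary σ (N + 1) q = fun ζ =>
      lacunary σ N q ζ + ((4 : ℝ) ^ (N + 1))⁻¹ ^ (σ + 1) * evenBump (q N) ζ := by
  ext ζ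
  exact Finset.sum_range_succ _ _

lemma hasCompactSupport_lacunary (σ N : ℕ) (q : ℕ → EuclideanSpace ℝ (Fin n)) :
    HasCompactSupport (lacunary σ N q) := by
  induction N with
  | zero =>
    have : lacunary σ 0 q = 0 := by ext; simp [lacunary]
    rw [this]
    exact HasCompactSupport.zero
  | succ N ih =>
    rw [lacunary_succ]
    exact ih.add (hasCompactSupport_evenBump (q N)).mul_left

lemma blockMass_lacunary_le_sum (χ : LPCutoff n) (σ N : ℕ) {t : ℝ} (ht : 0 < t)
    (q : ℕ → EuclideanSpace ℝ (Fin n)) :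
    blockMass χ σ t (lacunary σ N q) ≤ ∑ k ∈ Finset.range N,
      ((4 : ℝ) ^ (k + 1))⁻¹ ^ (σ + 1) * blockMass χ σ t (evenBump (q k)) := by
  induction N with
  | zero => simp [blockMass, lacunary]
  | succ N ih =>
    rw [lacunary_succ, Finset.sum_range_succ, ← blockMass_const_mul _ _ _ (by positivity)]
    refine (blockMass_add_le χ σ ht (contDiff_lacunary σ N q).continuous
      (hasCompactSupport_lacunary σ N q)
      (continuous_const.mul (contDiff_evenBump (q N)).continuous)
      (hasCompactSupport_evenBump (q N)).mul_left).trans ?_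
    exact add_le_add_left ih _

/-- The frequencies grow by a factor `4`, whereas the annulus has ratio `7/3`, so a block sees at
most one index `k`. Its weight cancels the `R^(σ+1)` of a single even bump, which makes the bound
independent of `N`. -/
lemma blockMass_lacunary_le (χ : LPCutoff n) {C : ℝ} (hC : ∀ ξ, |χ.annulus ξ| ≤ C) (σ N : ℕ)
    {t : ℝ} (ht : 0 < t) {q : ℕ → EuclideanSpace ℝ (Fin n)} (h1 : ∀ k, 4 ^ (k + 1) ≤ ‖q k‖)
    (h2 : ∀ k, ‖q k‖ ≤ 4 ^ (k + 1) + 1 / 2) :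
    blockMass χ σ t (lacunary σ N q) ≤ 4 ^ (σ + 1) * C * ∫ ζ, bump n ζ := by
  have hC0 : 0 ≤ C := (abs_nonneg _).trans (hC 0)
  have hβ : 0 ≤ ∫ ζ, bump n ζ := integral_nonneg bump_nonneg
  refine (blockMass_lacunary_le_sum χ σ N ht q).trans
    (sum_le_of_pairwise_eq_zero _ _ (by positivity) (fun k _ => ?_) ?_)
  · have h4 : (1 : ℝ) ≤ 4 ^ (k + 1) := one_le_pow₀ (by norm_num)
    have := blockMass_evenBump_le χ hC σ ht (q := q k) (R := 4 ^ (k + 1)) (by linarith [h2 k])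
    calc _ ≤ ((4 : ℝ) ^ (k + 1))⁻¹ ^ (σ + 1) *
          (4 ^ (σ + 1) * C * (∫ ζ, bump n ζ) * (4 ^ (k + 1)) ^ (σ + 1)) := by gcongr
      _ = 4 ^ (σ + 1) * C * (∫ ζ, bump n ζ) *
          (((4 : ℝ) ^ (k + 1))⁻¹ * 4 ^ (k + 1)) ^ (σ + 1) := by rw [mul_pow]; ring
      _ = _ := by rw [inv_mul_cancel₀ (by positivity), one_pow, mul_one]
  · have key : ∀ k l, k < l → blockMass χ σ t (evenBump (q k)) ≠ 0 →
        blockMass χ σ t (evenBump (q l)) ≠ 0 → False := by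
      intro k l hkl hk hl
      have hk := of_blockMass_evenBump_ne_zero χ σ ht hk
      have hl := of_blockMass_evenBump_ne_zero χ σ ht hl
      have h4 : (4 : ℝ) ≤ 4 ^ (k + 1) := le_self_pow₀ (by norm_num) (by omega)
      have h5 : (4 : ℝ) * 4 ^ (k + 1) ≤ 4 ^ (l + 1) := by
        rw [← pow_succ']
        exact pow_le_pow_right₀ (by norm_num) (by omega)
      linarith [h2 k, h1 l]
    intro k _ l _ hk hl
    rcases lt_trichotomy k l with h | h | h
    · exact (key k l h (right_ne_zero_of_mul hk) (right_ne_zero_of_mul hl)).elim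
    · exact h
    · exact (key l k h (right_ne_zero_of_mul hl) (right_ne_zero_of_mul hk)).elim

/-! ### Planar frequencies and kernel values -/

/-- The point with coordinates `X`, `Y` in the coordinate plane `(a, b)`. -/
def planePoint (a b : Fin n) (X Y : ℝ) : EuclideanSpace ℝ (Fin n) :=
  EuclideanSpace.single a X + EuclideanSpace.single b Y

lemma planePoint_fst {a b : Fin n} (hab : a ≠ b) (X Y : ℝ) : planePoint a b X Y a = X := by
  simp [planePoint, hab]

lemma planePoint_snd {a b : Fin n} (hab : a ≠ b) (X Y : ℝ) : planePoint a b X Y b = Y := by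
  simp [planePoint, hab.symm]

lemma planePoint_add (a b : Fin n) (X Y X' Y' : ℝ) :
    planePoint a b X Y + planePoint a b X' Y' = planePoint a b (X + X') (Y + Y') := by
  ext k
  simp only [planePoint, PiLp.add_apply, PiLp.single_apply]
  split_ifs <;> ring

lemma planePoint_neg (a b : Fin n) (X Y : ℝ) :
    -planePoint a b X Y = planePoint a b (-X) (-Y) := by
  ext k
  simp only [planePoint, PiLp.add_apply, PiLp.neg_apply, PiLp.single_apply]
  split_ifs <;> ring

lemma norm_planePoint_le (a b : Fin n) (X Y : ℝ) : ‖planePoint a b X Y‖ ≤ |X| + |Y| := by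
  refine (norm_add_le _ _).trans_eq ?_
  simp

lemma abs_apply_le_norm (x : EuclideanSpace ℝ (Fin n)) (k : Fin n) : |x k| ≤ ‖x‖ :=
  PiLp.norm_apply_le x k

lemma abs_sub_lt_of_norm_sub_planePoint {a b : Fin n} (hab : a ≠ b)
    {x : EuclideanSpace ℝ (Fin n)} {X Y d : ℝ} (h : ‖x - planePoint a b X Y‖ < d) :
    |x a - X| < d ∧ |x b - Y| < d := by
  have h1 := abs_apply_le_norm (x - planePoint a b X Y) a
  have h2 := abs_apply_le_norm (x - planePoint a b X Y) b
  rw [PiLp.sub_apply, planePoint_fst hab] at h1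
  rw [PiLp.sub_apply, planePoint_snd hab] at h2
  exact ⟨h1.trans_lt h, h2.trans_lt h⟩

lemma norm_add_sub_planePoint {a b : Fin n} {x y : EuclideanSpace ℝ (Fin n)} {X Y X' Y' : ℝ}
    (hx : ‖x - planePoint a b X Y‖ < 1 / 16) (hy : ‖y - planePoint a b X' Y'‖ < 1 / 16) :
    ‖y + x - planePoint a b (X + X') (Y + Y')‖ < 1 / 8 := by
  rw [← planePoint_add]
  calc _ = ‖(x - planePoint a b X Y) + (y - planePoint a b X' Y')‖ := by congr 1; abel
    _ ≤ _ := norm_add_le _ _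
    _ < 1 / 8 := by linarith

lemma exists_planePoint_of_evenBump_ne_zero {a b : Fin n} {X Y : ℝ}
    {ζ : EuclideanSpace ℝ (Fin n)} (h : evenBump (planePoint a b X Y) ζ ≠ 0) :
    ‖ζ - planePoint a b X Y‖ < 1 / 16 ∨ ‖ζ - planePoint a b (-X) (-Y)‖ < 1 / 16 := by
  rw [← planePoint_neg, sub_neg_eq_add]
  exact of_evenBump_ne_zero h

lemma norm_inv_smul {t : ℝ} (ht : 0 < t) (ζ : EuclideanSpace ℝ (Fin n)) :
    ‖t⁻¹ • ζ‖ = ‖ζ‖ / t := by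
  rw [norm_smul, norm_inv, Real.norm_of_nonneg ht.le, div_eq_inv_mul]

lemma pressureKernel_eq_zero_of_le (χ : LPCutoff n) {t : ℝ} (ht : 0 < t)
    {ζ : EuclideanSpace ℝ (Fin n)} (h : ‖ζ‖ ≤ t / 2) : pressureKernel χ t⁻¹ ζ = 0 := by
  rw [pressureKernel, χ.annulus_eq_zero_of_le, zero_mul]
  rw [norm_inv_smul ht, div_le_iff₀ ht]; linarith

lemma pressureKernel_eq_zero_of_lt (χ : LPCutoff n) {t : ℝ} (ht : 0 < t)
    {ζ : EuclideanSpace ℝ (Fin n)} (h : 7 / 6 * t < ‖ζ‖) : pressureKernel χ t⁻¹ ζ = 0 := by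
  rw [pressureKernel, χ.annulus_eq_zero_of_lt, zero_mul]
  rwa [norm_inv_smul ht, lt_div_iff₀ ht]

lemma inv_sq_le_pressureKernel (χ : LPCutoff n) {t : ℝ} (ht : 0 < t)
    {ζ : EuclideanSpace ℝ (Fin n)} (h : 7 / 12 * t < ‖ζ‖) (h' : ‖ζ‖ ≤ t) :
    (t ^ 2)⁻¹ ≤ pressureKernel χ t⁻¹ ζ := by
  have h0 : 0 < ‖ζ‖ := by linarith
  rw [pressureKernel, χ.annulus_eq_one, one_mul]
  · gcongr
  · rwa [norm_inv_smul ht, lt_div_iff₀ ht]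
  · rw [norm_inv_smul ht, div_le_iff₀ ht]; linarith

lemma sum_mul_le_sum_mul_sum (s : Finset ℕ) {f h : ℕ → ℝ} (hf : ∀ k, 0 ≤ f k)
    (hh : ∀ k, 0 ≤ h k) : ∑ k ∈ s, f k * h k ≤ (∑ k ∈ s, f k) * ∑ k ∈ s, h k := by
  rw [Finset.sum_mul]
  exact Finset.sum_le_sum fun k hk =>
    mul_le_mul_of_nonneg_left (Finset.single_le_sum (fun i _ => hh i) hk) (hf k)

lemma integral_bump_pos : 0 < ∫ ζ, bump n ζ := (bump n).integral_pos

lemma four_le_four_pow_succ (k : ℕ) : (4 : ℝ) ≤ 4 ^ (k + 1) :=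
  le_self_pow₀ (by norm_num) (by omega)

/-! ### The two inflating profiles -/

/-- The high-high interactions of pairs of opposite frequencies produce inflation for `σ = 0`. -/
lemma nonempty_inflationProfile_zero (χ : LPCutoff n) {a b : Fin n} (hab : a ≠ b) (M : ℝ) :
    Nonempty (InflationProfile χ a b 0 M) := by
  obtain ⟨C, hC0, hC⟩ := χ.exists_annulus_bound
  have hβ := integral_bump_pos (n := n)
  set β := ∫ ζ, bump n ζ with hβdef
  -- The block masses before scaling by `κ` are at most `8Cβ`, so this is more than small enough.
  set κ : ℝ := (64 * C * β)⁻¹ with hκ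
  have hκ0 : 0 < κ := by positivity
  have hκ1 : κ * (64 * C * β) = 1 := inv_mul_cancel₀ (by positivity)
  obtain ⟨N, hN⟩ := exists_nat_gt (M / (κ ^ 2 / 4 * β ^ 2))
  rw [div_lt_iff₀ (by positivity)] at hN
  -- The sum `q k + (-q' k)` is `(0, 3/4)` for every `k`. With the margin `1/8` it stays between
  -- `7/12` and `1`, where the cutoff at scale one equals `1`.
  set q : ℕ → EuclideanSpace ℝ (Fin n) := fun k => planePoint a b (4 ^ (k + 1)) (3 / 8) with hq
  set q' : ℕ → EuclideanSpace ℝ (Fin n) := fun k => planePoint a b (4 ^ (k + 1)) (-(3 / 8)) with hq'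
  have hlow : ∀ (k : ℕ) (Y : ℝ), 4 ^ (k + 1) ≤ ‖planePoint a b (4 ^ (k + 1)) Y‖ := fun k Y => by
    have := abs_apply_le_norm (planePoint a b (4 ^ (k + 1)) Y) a
    rw [planePoint_fst hab] at this
    exact (le_abs_self _).trans this
  have hup : ∀ (k : ℕ) (Y : ℝ), |Y| ≤ 1 / 2 →
      ‖planePoint a b (4 ^ (k + 1)) Y‖ ≤ 4 ^ (k + 1) + 1 / 2 := fun k Y hY => by
    have := norm_planePoint_le a b (4 ^ (k + 1)) Y
    rw [abs_of_pos (by positivity : (0 : ℝ) < 4 ^ (k + 1))] at this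
    linarith
  set G : EuclideanSpace ℝ (Fin n) → ℝ := fun ζ => lacunary 0 N q ζ + lacunary 0 N q' ζ with hG
  have hGs : ContDiff ℝ ∞ G := (contDiff_lacunary 0 N q).add (contDiff_lacunary 0 N q')
  have hGc : HasCompactSupport G :=
    (hasCompactSupport_lacunary 0 N q).add (hasCompactSupport_lacunary 0 N q')
  -- Only the divisibility of the first coordinate by `4` matters for the sign of the kernel: a
  -- nonzero sum of two such coordinates has size at least `4`, well outside the annulus.
  have hne : ∀ ζ, κ * G ζ ≠ 0 → ∃ (i : ℤ) (Y : ℝ), (Y = 3 / 8 ∨ Y = -(3 / 8)) ∧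
      ‖ζ - planePoint a b (4 * i) Y‖ < 1 / 16 := by
    intro ζ h
    have hk : ∀ k : ℕ, (4 : ℝ) ^ (k + 1) = 4 * ((4 ^ k : ℤ) : ℝ) := fun k => by
      push_cast; ring
    have hk' : ∀ k : ℕ, -(4 : ℝ) ^ (k + 1) = 4 * ((-4 ^ k : ℤ) : ℝ) := fun k => by
      push_cast; ring
    by_cases h1 : lacunary 0 N q ζ = 0
    · have h2 : lacunary 0 N q' ζ ≠ 0 := fun h2 => h (by simp [hG, h1, h2])
      obtain ⟨k, -, h3⟩ := of_lacunary_ne_zero h2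
      rcases exists_planePoint_of_evenBump_ne_zero h3 with h4 | h4
      · exact ⟨4 ^ k, _, Or.inr rfl, by rwa [← hk]⟩
      · exact ⟨-4 ^ k, _, Or.inl (neg_neg _), by rwa [← hk']⟩
    · obtain ⟨k, -, h3⟩ := of_lacunary_ne_zero h1
      rcases exists_planePoint_of_evenBump_ne_zero h3 with h4 | h4
      · exact ⟨4 ^ k, _, Or.inl rfl, by rwa [← hk]⟩
      · exact ⟨-4 ^ k, _, Or.inr rfl, by rwa [← hk']⟩
  have hform : N * (κ ^ 2 / 4) * β ^ 2 ≤ pressureForm χ a b (1 : ℝ)⁻¹ fun ζ => κ * G ζ := by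
    refine le_pressureForm χ a b _ (continuous_const.mul hGs.continuous) hGc.mul_left
      (bump n).continuous (bump n).hasCompactSupport bump_nonneg N q (fun k => -q' k)
      (fun k => κ ^ 2 * (((4 : ℝ) ^ (k + 1))⁻¹ ^ 2)) (fun k => by positivity) _ ?_ ?_ ?_
    · intro x y hx hy
      obtain ⟨i, Y, hY, hx⟩ := hne x hx
      obtain ⟨i', Y', hY', hy⟩ := hne y hy
      have hz := norm_add_sub_planePoint hx hy
      by_cases hi : i + i' = 0
      · have hX : 4 * (i : ℝ) + 4 * (i' : ℝ) = 0 := by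
          rw [← mul_add]; exact_mod_cast (by rw [hi]; norm_num)
        rw [hX] at hz
        have hd := norm_planePoint_le a b 0 (Y + Y')
        have hd' := (abs_apply_le_norm (planePoint a b 0 (Y + Y')) b)
        rw [planePoint_snd hab] at hd'
        rw [abs_zero, zero_add] at hd
        have h1 := abs_lt.1 ((abs_norm_sub_norm_le _ _).trans_lt hz)
        -- The first value falls inside the hole of the annulus, the second where the cutoff is `1`;
        -- neither meets a transition zone.
        have hc : |Y + Y'| = 0 ∨ |Y + Y'| = 3 / 4 := by
          rcases hY with rfl | rfl <;> rcases hY' with rfl | rfl <;> norm_num [abs_of_neg]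
        rcases hc with hc | hc
        · rw [pressureKernel_eq_zero_of_le χ one_pos (by linarith)]
        · exact le_trans (by positivity)
            (inv_sq_le_pressureKernel χ one_pos (by linarith) (by linarith))
      · rw [pressureKernel_eq_zero_of_lt χ one_pos]
        have h1 : (1 : ℝ) ≤ |(i : ℝ) + i'| := by exact_mod_cast Int.one_le_abs hi
        have h2 := (abs_sub_lt_of_norm_sub_planePoint hab hz).1
        have h3 := abs_apply_le_norm (y + x) a
        have h4 := abs_sub_abs_le_abs_sub (4 * (i : ℝ) + 4 * i') ((y + x) a)
        rw [abs_sub_comm, ← mul_add, abs_mul, abs_of_pos (by norm_num : (0 : ℝ) < 4)] at h4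
        rw [← mul_add] at h2
        linarith
    · intro x y
      have h1 : ∑ k ∈ Finset.range N, κ * (((4 : ℝ) ^ (k + 1))⁻¹ * bump n (x - q k)) ≤
          κ * G x := by
        rw [← Finset.mul_sum]
        gcongr
        refine le_trans (Finset.sum_le_sum fun k _ => ?_)
          (le_add_of_nonneg_right (lacunary_nonneg _ _ _ _))
        rw [zero_add, pow_one]
        gcongr
        exact bump_sub_le_evenBump _ _
      have h2 : ∑ k ∈ Finset.range N, κ * (((4 : ℝ) ^ (k + 1))⁻¹ * bump n (y - -q' k)) ≤
          κ * G y := by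
        rw [← Finset.mul_sum]
        gcongr
        refine le_trans (Finset.sum_le_sum fun k _ => ?_)
          (le_add_of_nonneg_left (lacunary_nonneg _ _ _ _))
        rw [zero_add, pow_one, sub_neg_eq_add]
        gcongr
        exact bump_add_le_evenBump _ _
      have h3 : ∀ (k : ℕ) (z : EuclideanSpace ℝ (Fin n)),
          0 ≤ κ * (((4 : ℝ) ^ (k + 1))⁻¹ * bump n z) := fun k z =>
        mul_nonneg hκ0.le (mul_nonneg (by positivity) (bump_nonneg _))
      calc _ = ∑ k ∈ Finset.range N, κ * (((4 : ℝ) ^ (k + 1))⁻¹ * bump n (x - q k)) *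
            (κ * (((4 : ℝ) ^ (k + 1))⁻¹ * bump n (y - -q' k))) :=
            Finset.sum_congr rfl fun k _ => by ring
        _ ≤ _ := sum_mul_le_sum_mul_sum _ (fun k => h3 k _) (fun k => h3 k _)
        _ ≤ _ := mul_le_mul h1 h2 (Finset.sum_nonneg fun k _ => h3 k _)
            ((Finset.sum_nonneg fun k _ => h3 k _).trans h1)
    · intro k _ x y hx hy
      have hx := norm_lt_of_bump_ne_zero hx
      have hy := norm_lt_of_bump_ne_zero hy
      simp only [hq, hq', planePoint_neg, neg_neg] at hx hy
      have hR := four_le_four_pow_succ k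
      set R : ℝ := 4 ^ (k + 1)
      have hz := norm_add_sub_planePoint hx hy
      rw [add_neg_cancel] at hz
      have hd := norm_planePoint_le a b 0 (3 / 8 + 3 / 8)
      have hd' := abs_apply_le_norm (planePoint a b 0 (3 / 8 + 3 / 8)) b
      rw [planePoint_snd hab, abs_of_pos (by norm_num)] at hd'
      rw [abs_zero, zero_add, abs_of_pos (by norm_num)] at hd
      have h1 := abs_lt.1 ((abs_norm_sub_norm_le _ _).trans_lt hz)
      have hK := inv_sq_le_pressureKernel χ one_pos (ζ := y + x) (by linarith) (by linarith)
      obtain ⟨hxa, hxb⟩ := abs_sub_lt_of_norm_sub_planePoint hab hx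
      obtain ⟨hya, hyb⟩ := abs_sub_lt_of_norm_sub_planePoint hab hy
      rw [abs_lt] at hxa hxb hya hyb
      -- At the centres `(R, 3/8)` and `(-R, 3/8)` both terms of the cross product are positive and
      -- total `3R/4`; the bump radii leave at least `R/2`.
      have hc : R / 2 ≤ cross a b x y := by
        have e1 : (R - 1 / 16) * (5 / 16) ≤ x a * y b :=
          mul_le_mul (by linarith) (by linarith) (by norm_num) (by linarith)
        have e2 : (5 / 16) * (R - 1 / 16) ≤ x b * (-y a) :=
          mul_le_mul (by linarith) (by linarith) (by linarith) (by linarith)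
        rw [cross]
        linarith
      have hc2 : (R / 2) ^ 2 ≤ cross a b x y ^ 2 := pow_le_pow_left₀ (by linarith) hc 2
      have hRK : (R / 2) ^ 2 ≤ pressureKernel χ (1 : ℝ)⁻¹ (y + x) * cross a b x y ^ 2 := by
        rw [one_pow, inv_one] at hK
        rw [inv_one]
        exact hc2.trans (le_mul_of_one_le_left (sq_nonneg _) hK)
      calc κ ^ 2 / 4 = κ ^ 2 * (R⁻¹ ^ 2) * (R / 2) ^ 2 := by
            have : R ≠ 0 := by linarith
            field_simp
            norm_num
        _ ≤ _ := by gcongr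
  refine ⟨⟨fun ζ => κ * G ζ, contDiff_const.mul hGs, hGc.mul_left, fun ζ => ?_, fun t ht => ?_, 0,
    ?_⟩⟩
  · simp only [hG, lacunary_neg]
  · change blockMass χ 0 t (fun ζ => κ * G ζ) ≤ 1 / 2
    rw [blockMass_const_mul _ _ _ hκ0.le]
    have h1 := blockMass_lacunary_le χ hC 0 N ht (q := q) (fun k => hlow k _)
      (fun k => hup k _ (by norm_num))
    have h2 := blockMass_lacunary_le χ hC 0 N ht (q := q') (fun k => hlow k _)
      (fun k => hup k _ (by norm_num))
    have h3 := blockMass_add_le χ 0 ht (contDiff_lacunary 0 N q).continuous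
      (hasCompactSupport_lacunary 0 N q) (contDiff_lacunary 0 N q').continuous
      (hasCompactSupport_lacunary 0 N q')
    rw [← hβdef, show (4 : ℝ) ^ (0 + 1) = 4 by norm_num] at h1 h2
    have h4 : blockMass χ 0 t G ≤ 8 * (C * β) := h3.trans (by linarith)
    calc _ ≤ κ * (8 * (C * β)) := by gcongr
      _ ≤ 1 / 2 := by linarith
  · rw [zpow_zero, pow_zero, one_pow, one_mul]
    linarith

/-- The interactions of a high frequency with many lower ones produce inflation for `σ = 1`. -/
lemma nonempty_inflationProfile_one (χ : LPCutoff n) {a b : Fin n} (hab : a ≠ b) (M : ℝ) :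
    Nonempty (InflationProfile χ a b 1 M) := by
  obtain ⟨C, hC0, hC⟩ := χ.exists_annulus_bound
  have hβ := integral_bump_pos (n := n)
  set β := ∫ ζ, bump n ζ with hβdef
  set κ : ℝ := (64 * C * β)⁻¹ with hκ
  have hκ0 : 0 < κ := by positivity
  have hκ1 : κ * (64 * C * β) = 1 := inv_mul_cancel₀ (by positivity)
  obtain ⟨N, hN⟩ := exists_nat_gt (M / (κ ^ 2 / 4 * β ^ 2))
  rw [div_lt_iff₀ (by positivity)] at hN
  set q : ℕ → EuclideanSpace ℝ (Fin n) := fun k => planePoint a b (4 ^ (k + 1)) 0 with hq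
  -- `T` is the scale of the inflated block. The extra powers of `4` keep all low frequencies below
  -- `T/16`, so adding one to the high frequency `3T/4` stays in the region where the cutoff is `1`.
  set T : ℝ := 4 ^ (N + 3) with hT
  have hT64 : 64 ≤ T := by
    have : (4 : ℝ) ^ 3 ≤ 4 ^ (N + 3) := pow_le_pow_right₀ (by norm_num) (by omega)
    linarith
  have hT0 : 0 < T := by linarith
  have hRT : ∀ k ∈ Finset.range N, (4 : ℝ) ^ (k + 1) ≤ T / 16 := by
    intro k hk
    have h1 : (4 : ℝ) ^ (k + 1) ≤ 4 ^ (N + 1) :=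
      pow_le_pow_right₀ (by norm_num) (by have := Finset.mem_range.1 hk; omega)
    have h2 : T = 4 ^ (N + 1) * 16 := by rw [hT]; ring
    linarith
  set H : ℝ := 3 / 4 * T with hH
  have hH0 : 0 < H := by linarith
  set p : EuclideanSpace ℝ (Fin n) := planePoint a b 0 H with hp
  have hpn : ‖p‖ ≤ H := by
    have := norm_planePoint_le a b 0 H
    rwa [abs_zero, zero_add, abs_of_pos hH0] at this
  have hpn' : H ≤ ‖p‖ := by
    have := abs_apply_le_norm p b
    rw [hp, planePoint_snd hab] at this
    exact (le_abs_self _).trans this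
  have hqn : ∀ k, ‖q k‖ ≤ 4 ^ (k + 1) := fun k => by
    have := norm_planePoint_le a b (4 ^ (k + 1)) 0
    rwa [abs_zero, add_zero, abs_of_pos (by positivity)] at this
  have hqn' : ∀ k, 4 ^ (k + 1) ≤ ‖q k‖ := fun k => by
    have := abs_apply_le_norm (q k) a
    rw [hq, planePoint_fst hab] at this
    exact (le_abs_self _).trans this
  have hEs := contDiff_evenBump p
  have hEc := hasCompactSupport_evenBump p
  set G : EuclideanSpace ℝ (Fin n) → ℝ :=
    fun ζ => lacunary 1 N q ζ + H⁻¹ ^ 2 * evenBump p ζ with hG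
  have hGs : ContDiff ℝ ∞ G := (contDiff_lacunary 1 N q).add (contDiff_const.mul hEs)
  have hGc : HasCompactSupport G := (hasCompactSupport_lacunary 1 N q).add hEc.mul_left
  have hne : ∀ ζ, κ * G ζ ≠ 0 →
      ‖ζ‖ ≤ T / 16 + 1 / 16 ∨ ‖ζ - p‖ < 1 / 16 ∨ ‖ζ + p‖ < 1 / 16 := by
    intro ζ h
    by_cases h1 : lacunary 1 N q ζ = 0
    · have h2 : evenBump p ζ ≠ 0 := fun h2 => h (by simp [hG, h1, h2])
      exact Or.inr (of_evenBump_ne_zero h2)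
    · obtain ⟨k, hk, h3⟩ := of_lacunary_ne_zero h1
      have h4 := abs_lt.1 (abs_norm_sub_norm_lt_of_evenBump_ne_zero h3)
      exact Or.inl (by linarith [hRT k hk, hqn k])
  have hmid : ∀ x y : EuclideanSpace ℝ (Fin n), ‖x‖ ≤ T / 16 + 1 / 16 →
      (‖y - p‖ < 1 / 16 ∨ ‖y + p‖ < 1 / 16) → (T ^ 2)⁻¹ ≤ pressureKernel χ T⁻¹ (y + x) := by
    intro x y hx hy
    have h1 : |‖y‖ - ‖p‖| < 1 / 16 := by
      rcases hy with hy | hy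
      · exact (abs_norm_sub_norm_le _ _).trans_lt hy
      · have := abs_norm_sub_norm_le y (-p)
        rw [norm_neg, sub_neg_eq_add] at this
        exact this.trans_lt hy
    rw [abs_lt] at h1
    have h2 := norm_add_le y x
    have h3 := norm_sub_le (y + x) x
    rw [add_sub_cancel_right] at h3
    exact inv_sq_le_pressureKernel χ hT0 (by linarith) (by linarith)
  have hform : N * (κ ^ 2 / (4 * T ^ 2)) * β ^ 2 ≤ pressureForm χ a b T⁻¹ fun ζ => κ * G ζ := by
    refine le_pressureForm χ a b _ (continuous_const.mul hGs.continuous) hGc.mul_left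
      (bump n).continuous (bump n).hasCompactSupport bump_nonneg N q (fun _ => p)
      (fun k => κ ^ 2 * (((4 : ℝ) ^ (k + 1))⁻¹ ^ 2 * H⁻¹ ^ 2)) (fun k => by positivity) _ ?_ ?_ ?_
    · intro x y hx hy
      have hpos : 0 ≤ (T ^ 2)⁻¹ := by positivity
      -- Low-low sums lie in the hole, mixed sums where the cutoff is `1`. High-high sums are near
      -- `±3T/2`, beyond the annulus, or near zero.
      rcases hne x hx with hx | hx <;> rcases hne y hy with hy | hy
      · rw [pressureKernel_eq_zero_of_le χ hT0]
        exact (norm_add_le _ _).trans (by linarith)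
      · exact hpos.trans (hmid x y hx hy)
      · rw [add_comm]; exact hpos.trans (hmid y x hy hx)
      · have hsame : ∀ v : EuclideanSpace ℝ (Fin n), H ≤ ‖v‖ → ‖x - v‖ < 1 / 16 →
            ‖y - v‖ < 1 / 16 → pressureKernel χ T⁻¹ (y + x) = 0 := by
          intro v hv hx hy
          refine pressureKernel_eq_zero_of_lt χ hT0 ?_
          have h1 : (2 : ℝ) • v = (y + x) - ((x - v) + (y - v)) := by rw [two_smul]; abel
          have h2 := norm_sub_le (y + x) ((x - v) + (y - v))
          rw [← h1, norm_smul, Real.norm_of_nonneg zero_le_two] at h2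
          have h3 := norm_add_le (x - v) (y - v)
          linarith
        have hopp : ∀ v : EuclideanSpace ℝ (Fin n), ‖x - v‖ < 1 / 16 →
            ‖y + v‖ < 1 / 16 → pressureKernel χ T⁻¹ (y + x) = 0 := by
          intro v hx hy
          refine pressureKernel_eq_zero_of_le χ hT0 ?_
          have h1 : y + x = (x - v) + (y + v) := by abel
          have h3 := norm_add_le (x - v) (y + v)
          rw [h1]
          linarith
        rcases hx with hx | hx <;> rcases hy with hy | hy
        · exact (hsame p hpn' hx hy).ge
        · exact (hopp p hx hy).ge
        · exact (hopp (-p) (by rwa [sub_neg_eq_add]) (by rwa [← sub_eq_add_neg])).ge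
        · exact (hsame (-p) (by rwa [norm_neg]) (by rwa [sub_neg_eq_add])
            (by rwa [sub_neg_eq_add])).ge
    · intro x y
      have h1 : ∑ k ∈ Finset.range N, κ * (((4 : ℝ) ^ (k + 1))⁻¹ ^ 2 * bump n (x - q k)) ≤
          κ * G x := by
        rw [← Finset.mul_sum]
        gcongr
        refine le_trans (Finset.sum_le_sum fun k _ => ?_)
          (le_add_of_nonneg_right (mul_nonneg (by positivity) (evenBump_nonneg _ _)))
        gcongr
        exact bump_sub_le_evenBump _ _
      have h2 : κ * (H⁻¹ ^ 2 * bump n (y - p)) ≤ κ * G y := by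
        gcongr
        refine le_trans ?_ (le_add_of_nonneg_left (lacunary_nonneg _ _ _ _))
        gcongr
        exact bump_sub_le_evenBump _ _
      have h3 : ∀ (k : ℕ) (z : EuclideanSpace ℝ (Fin n)),
          0 ≤ κ * (((4 : ℝ) ^ (k + 1))⁻¹ ^ 2 * bump n z) := fun k z =>
        mul_nonneg hκ0.le (mul_nonneg (by positivity) (bump_nonneg _))
      calc _ = (∑ k ∈ Finset.range N, κ * (((4 : ℝ) ^ (k + 1))⁻¹ ^ 2 * bump n (x - q k))) *
            (κ * (H⁻¹ ^ 2 * bump n (y - p))) := by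
            rw [Finset.sum_mul]
            exact Finset.sum_congr rfl fun k _ => by ring
        _ ≤ _ := mul_le_mul h1 h2 (mul_nonneg hκ0.le (mul_nonneg (by positivity) (bump_nonneg _)))
            ((Finset.sum_nonneg fun k _ => h3 k _).trans h1)
    · intro k hk x y hx hy
      have hx := norm_lt_of_bump_ne_zero hx
      have hy := norm_lt_of_bump_ne_zero hy
      have hR := four_le_four_pow_succ k
      have hxn := norm_sub_norm_le x (q k)
      have hK := hmid x y (by linarith [hRT k hk, hqn k]) (Or.inl hy)
      simp only [hq, hp] at hx hy
      set R : ℝ := 4 ^ (k + 1)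
      obtain ⟨hxa, hxb⟩ := abs_sub_lt_of_norm_sub_planePoint hab hx
      obtain ⟨hya, hyb⟩ := abs_sub_lt_of_norm_sub_planePoint hab hy
      rw [sub_zero] at hxb hya
      -- The frequencies are nearly orthogonal, so the main term is about `RH`. Its square cancels
      -- the weights `R⁻² H⁻²`, leaving `T⁻²` from the kernel, which the factor `2^(2j)` compensates
      -- at `2^j = T`.
      have hc : R * H / 2 ≤ cross a b x y := by
        have e3 : x b * y a ≤ 1 / 16 * (1 / 16) := by
          refine (le_abs_self _).trans ?_
          rw [abs_mul]
          gcongr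
        rw [abs_lt] at hxa hyb
        have e1 : (R - 1 / 16) * (H - 1 / 16) ≤ x a * y b :=
          mul_le_mul (by linarith) (by linarith) (by linarith) (by linarith)
        rw [cross]
        nlinarith
      have hc2 : (R * H / 2) ^ 2 ≤ cross a b x y ^ 2 := pow_le_pow_left₀ (by positivity) hc 2
      calc κ ^ 2 / (4 * T ^ 2) =
            κ ^ 2 * (R⁻¹ ^ 2 * H⁻¹ ^ 2) * ((T ^ 2)⁻¹ * (R * H / 2) ^ 2) := by
            have : R ≠ 0 := by linarith
            field_simp
            norm_num
        _ ≤ _ := mul_le_mul_of_nonneg_left (mul_le_mul hK hc2 (sq_nonneg _)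
            ((by positivity : 0 ≤ (T ^ 2)⁻¹).trans hK)) (by positivity)
  refine ⟨⟨fun ζ => κ * G ζ, contDiff_const.mul hGs, hGc.mul_left, fun ζ => ?_, fun t ht => ?_,
    ((2 * N + 6 : ℕ) : ℤ), ?_⟩⟩
  · simp only [hG, lacunary_neg, evenBump_neg]
  · change blockMass χ 1 t (fun ζ => κ * G ζ) ≤ 1 / 2
    rw [blockMass_const_mul _ _ _ hκ0.le]
    have h1 := blockMass_lacunary_le χ hC 1 N ht hqn' (fun k => (hqn k).trans (by norm_num))
    have h2 := blockMass_evenBump_le χ hC 1 ht (q := p) (R := H) (by linarith)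
    have h3 := blockMass_add_le χ 1 ht (contDiff_lacunary 1 N q).continuous
      (hasCompactSupport_lacunary 1 N q) (continuous_const.mul hEs.continuous)
      (hEc.mul_left (f := fun _ => H⁻¹ ^ 2))
    have h6 : blockMass χ 1 t ((fun _ => H⁻¹ ^ 2) * evenBump p) =
        H⁻¹ ^ 2 * blockMass χ 1 t (evenBump p) := blockMass_const_mul _ _ _ (by positivity) _
    rw [h6] at h3
    rw [← hβdef, show (4 : ℝ) ^ (1 + 1) = 16 by norm_num] at h1 h2
    have h5 : H⁻¹ ^ 2 * blockMass χ 1 t (evenBump p) ≤ 16 * (C * β) := by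
      calc _ ≤ H⁻¹ ^ 2 * (16 * C * β * H ^ (1 + 1)) := by gcongr
        _ = 16 * (C * β) := by field_simp
    have h4 : blockMass χ 1 t G ≤ 32 * (C * β) := h3.trans (by linarith)
    calc _ ≤ κ * (32 * (C * β)) := by gcongr
      _ ≤ 1 / 2 := by linarith
  · have h2T : (2 : ℝ) ^ ((2 * N + 6 : ℕ) : ℤ) = T := by
      rw [zpow_natCast, hT, show 2 * N + 6 = 2 * (N + 3) by ring, pow_mul]
      norm_num
    rw [h2T, pow_one]
    calc M < N * (κ ^ 2 / 4 * β ^ 2) := hN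
      _ = T ^ 2 * (N * (κ ^ 2 / (4 * T ^ 2)) * β ^ 2) := by field_simp
      _ ≤ _ := by gcongr

end EulerPressure

end

theorem theorem1p4 (n : ℕ) (hn : 2 ≤ n) (χ : EulerPressure.LPCutoff n)
    (s : ℝ) (hs : s = 1 ∨ s = 0) :
    (¬ ∃ C : ℝ≥0, ∀ u : 𝓢(EuclideanSpace ℝ (Fin n), EuclideanSpace ℝ (Fin n)),
      EulerPressure.IsDivFree u →
        EulerPressure.besovNorm χ (2 * s) (EulerPressure.pressure u) ≤
          C * EulerPressure.besovNorm χ s (EulerPressure.velocityL2 u) ^ 2) ∧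
    (∀ ε : ℝ, 0 < ε → ∀ N : ℤ,
      ∃ u : 𝓢(EuclideanSpace ℝ (Fin n), EuclideanSpace ℝ (Fin n)),
        EulerPressure.IsDivFree u ∧
        EulerPressure.besovNorm χ s (EulerPressure.velocityL2 u) + eLpNorm u 2 volume ≤ 1 ∧
        ENNReal.ofReal (1 / ε) < EulerPressure.besovNorm χ (2 * s) (EulerPressure.pressure u) ∧
        ∃ j : ℤ, N ≤ j ∧
          ENNReal.ofReal (1 / ε) <
            EulerPressure.blockNorm χ (2 * s) j (EulerPressure.pressure u)) := by
  have hab : (⟨0, by omega⟩ : Fin n) ≠ ⟨1, by omega⟩ := by simp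
  have key : ∀ M : ℝ, 0 ≤ M → ∀ N : ℤ,
      ∃ u : 𝓢(EuclideanSpace ℝ (Fin n), EuclideanSpace ℝ (Fin n)), EulerPressure.IsDivFree u ∧
        EulerPressure.besovNorm χ s (EulerPressure.velocityL2 u) ≤ ENNReal.ofReal (1 / 2) ∧
        eLpNorm u 2 volume ≤ ENNReal.ofReal (1 / 2) ∧
        ∃ j : ℤ, N ≤ j ∧ ENNReal.ofReal M <
          EulerPressure.blockNorm χ (2 * s) j (EulerPressure.pressure u) := by
    intro M hM N
    rcases hs with rfl | rfl
    · obtain ⟨P⟩ := EulerPressure.nonempty_inflationProfile_one χ hab M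
      simpa using P.exists_velocity hab hM N
    · obtain ⟨P⟩ := EulerPressure.nonempty_inflationProfile_zero χ hab M
      simpa using P.exists_velocity hab hM N
  have hhalf : ENNReal.ofReal (1 / 2) + ENNReal.ofReal (1 / 2) = 1 := by
    rw [← ENNReal.ofReal_add (by norm_num) (by norm_num)]; norm_num
  constructor
  · rintro ⟨C, hC⟩
    -- Inflation beyond `C` itself suffices, because the velocity norm is at most `1`.
    obtain ⟨u, hdiv, hu, -, j, -, hj⟩ := key C C.coe_nonneg 0
    rw [ENNReal.ofReal_coe_nnreal] at hj
    have hle : ENNReal.ofReal (1 / 2) ≤ 1 := by rw [← hhalf]; exact le_self_add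
    have h1 : EulerPressure.besovNorm χ s (EulerPressure.velocityL2 u) ^ 2 ≤ 1 :=
      pow_le_one₀ zero_le (hu.trans hle)
    refine (hj.trans_le ?_).false
    calc _ ≤ EulerPressure.besovNorm χ (2 * s) (EulerPressure.pressure u) :=
          le_iSup (fun j => EulerPressure.blockNorm χ (2 * s) j (EulerPressure.pressure u)) j
      _ ≤ _ := hC u hdiv
      _ ≤ C * 1 := by gcongr
      _ = C := mul_one _
  · intro ε hε N
    obtain ⟨u, hdiv, hu, hu2, j, hNj, hj⟩ := key (1 / ε) (by positivity) N
    exact ⟨u, hdiv, (add_le_add hu hu2).trans_eq hhalf, hj.trans_le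
      (le_iSup (fun j => EulerPressure.blockNorm χ (2 * s) j (EulerPressure.pressure u)) j),
      j, hNj, hj⟩
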